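/- Let $k\ge 2$, let $L=\bigoplus_{i=1}^k\mathbb{Z}v_i$ with dual coordinates $\epsilon_i$, and let $F(L)$ be the space of all functions $L\to\mathbb{C}$. The Weyl group $W=\mathfrak{S}_k$ acts on $L$ by $wv_i=v_{w(i)}$; it is generated by the simple reflections $s_i=(i,i+1)$, and length and reduced expressions in $W$ refer to them. Let $\alpha,\beta,\gamma,\delta\in\mathbb{C}$, put $q=1+\beta\gamma-\alpha\delta$ and $[m]=\frac{1-q^m}{1-q}=1+q+\cdots+q^{m-1}$, $[m]!=[1]\cdots[m]$, and assume that $q\ne0$ and that $1+\beta\gamma[m]\neq0$ for every integer $m\ge1$. Let $\mathbb{C}[L]$ be the group algebra with basis $e^x$ $(x\in L)$, let $P\mapsto P.s_i$ be the linear map with $e^x.s_i=e^{s_ix}$, and let $\check X_i$ $(1\le i\le k)$ and $\check T_i$ $(1\le i<k)$ be the operators on $\mathbb{C}[L]$, written on the right, $$P\check X_i=e^{-v_i}P,\qquad P\check T_i=P.s_i+\frac{(\alpha e^{v_i}+\beta)(\gamma e^{v_{i+1}}+\delta)}{e^{v_i}-e^{v_{i+1}}}\,(P-P.s_i).$$ Let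 $\widehat X_i,\widehat T_i$ be their transposes on $F(L)$ with respect to the bilinear pairing $(e^x,f)=f(x)$; thus $(\widehat X_if)(x)=f(x-v_i)$. For $w\in W$ with a reduced expression $w=s_{i_1}\cdots s_{i_r}$ put $\widehat T_w=\widehat T_{i_1}\cdots\widehat T_{i_r}$ (this does not depend on the reduced expression). For $x\in L$ let $w_x$ be the unique shortest element of $W$ with $\epsilon_1(w_xx)\ge\cdots\ge\epsilon_k(w_xx)$. The propagation operator $G:F(L)\to F(L)$ is $$G(f)(x)=(\widehat T_{w_x}f)(w_xx).$$ For $x\in L$ let $d_i^+(x)=\#\{p>i:\epsilon_p(x)=\epsilon_i(x)\}$ and $d_i^-(x)=\#\{p<i:\epsilon_p(x)=\epsilon_i(x)\}$, and let $\delta_{j_1,\ldots,j_r}(x)$ be $1$ if $\epsilon_{j_1}(x)=\cdots=\epsilon_{j_r}(x)$ and $0$ otherwise. The discrete Hamiltonian is the operator on $F(L)$ $$H=-\alpha\gamma\sum_{j=1}^k\frac{[d_j^+]}{1+\beta\gamma[d_j^+]}+\sum_{r=1}^k(-\beta\delta)^{r-1}[r-1]!\,q^{-r(r-1)/2}\sum_{1\le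 j_1<\cdots<j_r\le k}\frac{q^{\sum_{p=1}^rd_{j_p}^-}\,\delta_{j_1,\ldots,j_r}}{\prod_{p=0}^{r-1}\bigl(1+\beta\gamma[d_{j_1}^++d_{j_1}^--p]\bigr)}\,\widehat X_{j_1}\cdots\widehat X_{j_r},$$ where functions of $x$ act by multiplication and terms with $\delta_{j_1,\ldots,j_r}(x)=0$ are zero. Then $HG=G\bigl(\sum_{i=1}^k\widehat X_i\bigr)$. Consequently, if a nonzero $f\in F(L)$ satisfies $\bigl(\sum_{i=1}^k\widehat X_i\bigr)f=cf$ with $c\in\mathbb{C}$, then $G(f)\neq0$ and $H\,G(f)=c\,G(f)$; that is, $G$ maps eigenfunctions of $\sum_i\widehat X_i$ to eigenfunctions of $H$ with the same eigenvalue. -/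

import Mathlib

/-! The number of particles is `k = n + 1`. Indices of coordinates and of the variables `X_i` are
`Fin (n + 1)` (so the `i`-th index of a `1`-based numbering is `i - 1` here); the simple
reflections and the operators `T_i` are indexed by `i : Fin n`, where `i.castSucc` and `i.succ`
are the two neighbouring coordinates on which they act. -/

noncomputable section

namespace DeformedHecke

/-! ### The lattice, its functions, the Weyl group -/

/-- The lattice `L = ⊕ ℤ v_i`; the coordinate `x i` is `ε_i(x)`. -/
abbrev Lat (n : ℕ) : Type := Fin (n + 1) → ℤ

/-- The space `F(L)` of complex-valued functions on `L`. -/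
abbrev Fun (n : ℕ) : Type := Lat n → ℂ

/-- The group algebra `ℂ[L]`. -/
abbrev GrpAlg (n : ℕ) : Type := AddMonoidAlgebra ℂ (Lat n)

/-- The basis vector `v_i`. -/
def v {n : ℕ} (i : Fin (n + 1)) : Lat n := Pi.single i 1

/-- The simple root `a_i = ε_i - ε_{i+1}`. -/
def root {n : ℕ} (i : Fin n) (x : Lat n) : ℤ := x i.castSucc - x i.succ

/-- The simple coroot `v_i - v_{i+1}`. -/
def coroot {n : ℕ} (i : Fin n) : Lat n := v i.castSucc - v i.succ

/-- The Weyl group of type `A_{k-1}` is the group of permutations of the coordinates. -/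
abbrev Weyl (n : ℕ) : Type := Equiv.Perm (Fin (n + 1))

/-- The linear action of the Weyl group on `L`, given by `w v_i = v_{w(i)}`. -/
def act {n : ℕ} (w : Weyl n) (x : Lat n) : Lat n := fun i => x (w⁻¹ i)

theorem act_v {n : ℕ} (w : Weyl n) (i : Fin (n + 1)) : act w (v i) = v (w i) := by
  funext j
  simp only [act, v, Pi.single_apply, Equiv.Perm.inv_eq_iff_eq]

theorem act_mul {n : ℕ} (u w : Weyl n) (x : Lat n) : act (u * w) x = act u (act w x) := by
  funext j
  simp [act]

/-- The simple reflection `s_i`. -/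
def s {n : ℕ} (i : Fin n) : Weyl n := Equiv.swap i.castSucc i.succ

theorem act_s {n : ℕ} (i : Fin n) (x : Lat n) : act (s i) x = x - root i x • coroot i := by
  have hne : i.castSucc ≠ i.succ := (Fin.castSucc_lt_succ).ne
  funext j
  simp only [act, s, Equiv.swap_inv, Pi.sub_apply, Pi.smul_apply, coroot, v, Pi.single_apply,
    root, smul_eq_mul]
  by_cases h1 : j = i.castSucc
  · subst h1
    simp [hne]
  · by_cases h2 : j = i.succ
    · subst h2
      simp [hne.symm]
    · simp [Equiv.swap_apply_of_ne_of_ne h1 h2, h1, h2]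

/-- The product `s_{i_1} ⋯ s_{i_r}` of a word in the simple reflections. -/
def wordProd {n : ℕ} (l : List (Fin n)) : Weyl n := (l.map s).prod

theorem exists_word {n : ℕ} (w : Weyl n) : ∃ l : List (Fin n), wordProd l = w := by
  have hw : w ∈ Submonoid.closure (Set.range fun i : Fin n => Equiv.swap i.castSucc i.succ) := by
    rw [Equiv.Perm.mclosure_swap_castSucc_succ]
    trivial
  induction hw using Submonoid.closure_induction with
  | mem x hx =>
    obtain ⟨i, rfl⟩ := hx
    exact ⟨[i], by simp [wordProd, s]⟩
  | one => exact ⟨[], rfl⟩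
  | mul x y _ _ hx hy =>
    obtain ⟨l, rfl⟩ := hx
    obtain ⟨l', rfl⟩ := hy
    exact ⟨l ++ l', by simp [wordProd]⟩

/-- The length `ℓ(w)`: the least number of simple reflections with product `w`. -/
def len {n : ℕ} (w : Weyl n) : ℕ := sInf {m | ∃ l : List (Fin n), wordProd l = w ∧ l.length = m}

/-- The word `l` is a reduced expression of `w`. -/
def IsReduced {n : ℕ} (l : List (Fin n)) (w : Weyl n) : Prop := wordProd l = w ∧ l.length = len w

theorem exists_isReduced {n : ℕ} (w : Weyl n) : ∃ l : List (Fin n), IsReduced l w := by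
  obtain ⟨l, hl⟩ := exists_word w
  exact Nat.sInf_mem (s := {m | ∃ l : List (Fin n), wordProd l = w ∧ l.length = m})
    ⟨l.length, l, hl, rfl⟩

/-- The lattice points of the closed fundamental chamber. -/
def Dominant {n : ℕ} (x : Lat n) : Prop := ∀ i : Fin n, 0 ≤ root i x

/-- The element `w` is a shortest one with `w x` in the closed fundamental chamber. -/
def IsShortest {n : ℕ} (x : Lat n) (w : Weyl n) : Prop :=
  Dominant (act w x) ∧ ∀ u : Weyl n, Dominant (act u x) → len w ≤ len u

theorem exists_isShortest {n : ℕ} (x : Lat n) : ∃ w : Weyl n, IsShortest x w := by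
  have hex : ∃ w : Weyl n, Dominant (act w x) := by
    refine ⟨(Tuple.sort fun i => - x i)⁻¹, fun i => ?_⟩
    have h := Tuple.monotone_sort (fun i => - x i) (Fin.castSucc_lt_succ (i := i)).le
    simp only [Function.comp_apply] at h
    simp only [root, act, inv_inv]
    linarith
  obtain ⟨w, hw, hmin⟩ :=
    WellFounded.has_min (measure (len (n := n))).wf {w | Dominant (act w x)} hex
  exact ⟨w, hw, fun u hu => not_lt.mp (hmin u hu)⟩

/-- The (unique) shortest element `w_x` with `w_x x` in the closed fundamental chamber. -/
def wmin {n : ℕ} (x : Lat n) : Weyl n := Classical.choose (exists_isShortest x)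

/-! ### The right action on `ℂ[L]` -/

/-- The element `e^x` of `ℂ[L]`. -/
def e {n : ℕ} (x : Lat n) : GrpAlg n := AddMonoidAlgebra.single x 1

/-- The linear extension to `ℂ[L]` of a map given on the basis `e^x`. -/
def extend {n : ℕ} {M : Type*} [AddCommMonoid M] [Module ℂ M] (g : Lat n → M) :
    GrpAlg n →ₗ[ℂ] M where
  toFun P := Finsupp.linearCombination ℂ g P.coeff
  map_add' P Q := by simp
  map_smul' c P := by simp

@[simp]
theorem extend_e {n : ℕ} {M : Type*} [AddCommMonoid M] [Module ℂ M] (g : Lat n → M) (x : Lat n) :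
    extend g (e x) = g x := by
  simp [extend, e]

theorem hom_ext {n : ℕ} {M : Type*} [AddCommMonoid M] [Module ℂ M] {A B : GrpAlg n →ₗ[ℂ] M}
    (h : ∀ x, A (e x) = B (e x)) : A = B := by
  refine LinearMap.ext fun P => ?_
  induction P using AddMonoidAlgebra.induction_linear with
  | zero => simp
  | add P Q hP hQ => rw [map_add, map_add, hP, hQ]
  | single x c =>
    have hx : (AddMonoidAlgebra.single x c : GrpAlg n) = c • e x := by simp [e]
    rw [hx, map_smul, map_smul, h]

/-- The right action `P ↦ P.w` of the Weyl group on `ℂ[L]`, with `e^x.w = e^{w⁻¹ x}`. -/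
def rightAct {n : ℕ} (w : Weyl n) : GrpAlg n →ₗ[ℂ] GrpAlg n := extend fun x => e (act w⁻¹ x)

/-- The divided difference `P ↦ (P - P.s_i) / (e^{v_i} - e^{v_{i+1}})`, which is exact; it is
given here through its values on the basis, and `divDiff_spec` with `divDiff_unique` states that
it is the quotient. -/
def divDiff {n : ℕ} (i : Fin n) : GrpAlg n →ₗ[ℂ] GrpAlg n := extend fun x =>
  (∑ j ∈ Finset.range (root i x).toNat, e (act (s i) x + (j : ℤ) • coroot i - v i.succ)) -
    ∑ j ∈ Finset.range (-root i x).toNat, e (x + (j : ℤ) • coroot i - v i.succ)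

theorem e_add {n : ℕ} (x y : Lat n) : e (x + y) = e x * e y := by
  simp [e, AddMonoidAlgebra.single_mul_single]

theorem mul_geom {n : ℕ} (i : Fin n) (x : Lat n) (m : ℕ) :
    (e (v i.castSucc) - e (v i.succ)) *
      ∑ j ∈ Finset.range m, e (x + (j : ℤ) • coroot i - v i.succ) =
      e (x + (m : ℤ) • coroot i) - e x := by
  induction m with
  | zero => simp
  | succ m ih =>
    rw [Finset.sum_range_succ, mul_add, ih, sub_mul, ← e_add, ← e_add]
    have h1 : v i.castSucc + (x + (m : ℤ) • coroot i - v i.succ) =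
        x + ((m + 1 : ℕ) : ℤ) • coroot i := by
      rw [Nat.cast_succ, add_smul, one_smul]
      unfold coroot
      abel
    have h2 : v i.succ + (x + (m : ℤ) • coroot i - v i.succ) = x + (m : ℤ) • coroot i := by abel
    rw [h1, h2]
    abel

theorem divDiff_spec {n : ℕ} (i : Fin n) (P : GrpAlg n) :
    (e (v i.castSucc) - e (v i.succ)) * divDiff i P = P - rightAct (s i) P := by
  have key : LinearMap.mulLeft ℂ (e (v i.castSucc) - e (v i.succ)) ∘ₗ divDiff i =
      LinearMap.id - rightAct (s i) := by
    refine hom_ext fun x => ?_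
    have hs : (s i)⁻¹ = s i := by simp [s]
    simp only [LinearMap.comp_apply, LinearMap.mulLeft_apply, divDiff, extend_e,
      LinearMap.sub_apply, LinearMap.id_apply, rightAct, hs, mul_sub, mul_geom]
    rcases le_total 0 (root i x) with h | h
    · have h0 : (-root i x).toNat = 0 := Int.toNat_of_nonpos (by omega)
      rw [h0, Int.toNat_of_nonneg h, act_s]
      simp
    · have h0 : (root i x).toNat = 0 := Int.toNat_of_nonpos h
      rw [h0, Int.toNat_of_nonneg (by omega : 0 ≤ -root i x), act_s, neg_smul, ← sub_eq_add_neg]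
      simp
  exact LinearMap.congr_fun key P

theorem divDiff_unique {n : ℕ} (i : Fin n) (P Q : GrpAlg n)
    (h : (e (v i.castSucc) - e (v i.succ)) * Q = P - rightAct (s i) P) : Q = divDiff i P := by
  have hne : e (v i.castSucc) - e (v i.succ) ≠ 0 := by
    intro h0
    have h1 : v i.castSucc = v i.succ :=
      (AddMonoidAlgebra.single_left_inj (one_ne_zero (α := ℂ))).mp (sub_eq_zero.mp h0)
    have h2 := congrFun h1 i.castSucc
    simp [v, (Fin.castSucc_lt_succ (i := i)).ne] at h2
  exact mul_left_cancel₀ hne (h.trans (divDiff_spec i P).symm)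

/-- The operator `P ↦ P X̌_i = e^{-v_i} P`. -/
def Xcheck {n : ℕ} (i : Fin (n + 1)) : GrpAlg n →ₗ[ℂ] GrpAlg n := LinearMap.mulLeft ℂ (e (-v i))

/-- The operator `P ↦ P Ť_i`, that is
`P.s_i + (α e^{v_i} + β) (γ e^{v_{i+1}} + δ) (P - P.s_i) / (e^{v_i} - e^{v_{i+1}})`. -/
def Tcheck (α β γ δ : ℂ) {n : ℕ} (i : Fin n) : GrpAlg n →ₗ[ℂ] GrpAlg n :=
  rightAct (s i) + LinearMap.mulLeft ℂ
    ((α • e (v i.castSucc) + β • (1 : GrpAlg n)) * (γ • e (v i.succ) + δ • (1 : GrpAlg n))) ∘ₗ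
      divDiff i

/-! ### The left action on `F(L)` -/

/-- The bilinear pairing `ℂ[L] × F(L) → ℂ` with `(e^x, f) = f x`. -/
def pairing {n : ℕ} (P : GrpAlg n) (f : Fun n) : ℂ := extend f P

/-- The transpose of an operator on `ℂ[L]` with respect to the pairing. -/
def transpose {n : ℕ} (A : GrpAlg n →ₗ[ℂ] GrpAlg n) : Module.End ℂ (Fun n) where
  toFun f x := pairing (A (e x)) f
  map_add' f g := by
    funext x
    simp [pairing, extend, Finsupp.linearCombination_apply, Finsupp.sum, mul_add,
      Finset.sum_add_distrib]
  map_smul' c f := by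
    funext x
    simp [pairing, extend, Finsupp.linearCombination_apply, Finsupp.sum, Finset.mul_sum,
      mul_left_comm]

theorem pairing_transpose {n : ℕ} (A : GrpAlg n →ₗ[ℂ] GrpAlg n) (P : GrpAlg n) (f : Fun n) :
    pairing (A P) f = pairing P (transpose A f) := by
  have key : extend f ∘ₗ A = extend (transpose A f) := by
    refine hom_ext fun x => ?_
    rw [extend_e]
    rfl
  exact LinearMap.congr_fun key P

/-- The operator `X̂_i` on `F(L)`. -/
def Xhat {n : ℕ} (i : Fin (n + 1)) : Module.End ℂ (Fun n) := transpose (Xcheck i)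

theorem Xhat_apply {n : ℕ} (i : Fin (n + 1)) (f : Fun n) (x : Lat n) :
    Xhat i f x = f (x - v i) := by
  simp only [Xhat, transpose, LinearMap.coe_mk, AddHom.coe_mk, pairing, Xcheck,
    LinearMap.mulLeft_apply, ← e_add, extend_e, neg_add_eq_sub]

/-- The operator `T̂_i` on `F(L)`. -/
def That (α β γ δ : ℂ) {n : ℕ} (i : Fin n) : Module.End ℂ (Fun n) :=
  transpose (Tcheck α β γ δ i)

/-- The operator `T̂_w = T̂_{i_1} ⋯ T̂_{i_r}` for a reduced expression `w = s_{i_1} ⋯ s_{i_r}`.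
(By the braid relations between the `T̂_i` it does not depend on the reduced expression.) -/
def ThatW (α β γ δ : ℂ) {n : ℕ} (w : Weyl n) : Module.End ℂ (Fun n) :=
  ((Classical.choose (exists_isReduced w)).map (That α β γ δ)).prod

/-- The propagation operator `G`. -/
def G (α β γ δ : ℂ) (n : ℕ) : Module.End ℂ (Fun n) where
  toFun f x := ThatW α β γ δ (wmin x) f (act (wmin x) x)
  map_add' f g := by
    funext x
    simp
  map_smul' c f := by
    funext x
    simp

/-! ### The discrete Hamiltonian -/

/-- The parameter `q = 1 + βγ - αδ`. -/
def qpar (α β γ δ : ℂ) : ℂ := 1 + β * γ - α * δ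

/-- The `q`-integer `[m] = (1 - q^m) / (1 - q)`, as the polynomial `1 + q + ⋯ + q^{m-1}` in `q`
(so that `[m] = m` for `q = 1`). -/
def qint (q : ℂ) (m : ℕ) : ℂ := ∑ a ∈ Finset.range m, q ^ a

theorem qint_eq {q : ℂ} (hq : q ≠ 1) (m : ℕ) : qint q m = (1 - q ^ m) / (1 - q) := by
  rw [qint, geom_sum_eq hq, ← neg_sub (1 : ℂ) (q ^ m), ← neg_sub (1 : ℂ) q, neg_div_neg_eq]

/-- The `q`-factorial `[m]! = [1] [2] ⋯ [m]`. -/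
def qfact (q : ℂ) (m : ℕ) : ℂ := ∏ a ∈ Finset.range m, qint q (a + 1)

/-- The function `d_i^+`. -/
def dplus {n : ℕ} (i : Fin (n + 1)) (x : Lat n) : ℕ :=
  (Finset.univ.filter fun p : Fin (n + 1) => i < p ∧ x i = x p).card

/-- The function `d_i^-`. -/
def dminus {n : ℕ} (i : Fin (n + 1)) (x : Lat n) : ℕ :=
  (Finset.univ.filter fun p : Fin (n + 1) => p < i ∧ x p = x i).card

/-- The function `δ_{j_1, …, j_m}`. -/
def delta {n m : ℕ} (j : Fin m → Fin (n + 1)) (x : Lat n) : ℂ :=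
  if ∀ p p', x (j p) = x (j p') then 1 else 0

/-- Where `δ_{j_1, …, j_m}` does not vanish, the differences `d_{j_1}^+ + d_{j_1}^- - p` with
`0 ≤ p ≤ m - 1` are natural numbers. -/
theorem le_dplus_add_dminus {n r : ℕ} (j : Fin (r + 1) ↪o Fin (n + 1)) (x : Lat n)
    (h : delta j x ≠ 0) : r ≤ dplus (j 0) x + dminus (j 0) x := by
  have hx : ∀ p p', x (j p) = x (j p') := by
    by_contra hc
    exact h (if_neg hc)
  have h1 : ((Finset.univ : Finset (Fin r)).map
      ((Fin.succEmb r).trans j.toEmbedding)).card ≤ dplus (j 0) x := by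
    refine Finset.card_le_card fun p hp => ?_
    obtain ⟨t, -, rfl⟩ := Finset.mem_map.mp hp
    exact Finset.mem_filter.mpr ⟨Finset.mem_univ _, j.strictMono (Fin.succ_pos t), hx _ _⟩
  rw [Finset.card_map, Finset.card_univ, Fintype.card_fin] at h1
  omega

/-- The discrete Hamiltonian `H`. The sum over the number `m = r + 1` of indices runs over
`1 ≤ m ≤ k = n + 1`, and the tuples `j_1 < ⋯ < j_m` are the order embeddings `j`, with `j_1` equal
to `j 0`. The natural subtraction in `[d_{j_1}^+ + d_{j_1}^- - p]` truncates only in terms in which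
the factor `δ_{j_1, …, j_m}` vanishes. -/
def H (α β γ δ : ℂ) (n : ℕ) : Module.End ℂ (Fun n) where
  toFun f x :=
    -(α * γ) * (∑ j : Fin (n + 1), qint (qpar α β γ δ) (dplus j x) /
        (1 + β * γ * qint (qpar α β γ δ) (dplus j x))) * f x +
    ∑ r ∈ Finset.range (n + 1),
      (-(β * δ)) ^ r * qfact (qpar α β γ δ) r * (qpar α β γ δ ^ ((r + 1) * r / 2))⁻¹ *
      ∑ j : Fin (r + 1) ↪o Fin (n + 1),
        qpar α β γ δ ^ (∑ p, dminus (j p) x) * delta j x /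
          (∏ p ∈ Finset.range (r + 1),
            (1 + β * γ * qint (qpar α β γ δ) (dplus (j 0) x + dminus (j 0) x - p))) *
          (List.ofFn fun p => Xhat (j p)).prod f x
  map_add' f g := by
    funext x
    simp only [map_add, Pi.add_apply, mul_add, Finset.sum_add_distrib]
    ring
  map_smul' c f := by
    funext x
    simp only [map_smul, Pi.smul_apply, smul_eq_mul, RingHom.id_apply, mul_add, Finset.mul_sum]
    congr 1
    · ring
    · refine Finset.sum_congr rfl fun r _ => Finset.sum_congr rfl fun j _ => ?_
      ring

end DeformedHecke

end

noncomputable section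

namespace DeformedHecke

/-! Write z_k = e^{-v_k}. By transposition, G is encoded by elements `propag x` of ℂ[L] with G f x =
(`propag x`, f). For dominant x this element is e^x, and Ť_i carries `propag x` to `propag (act (s
i) x)` whenever ε_i(x) ≥ ε_{i+1}(x) (`Tcheck_propag`), a consequence of the braid relations. The
intertwining relation becomes an identity in ℂ[L]: (∑ z_k) · `propag x` is the combination of the
elements `propag (x - ind J)`, with J inside a level set of x, whose coefficients are those of H
(`zsum_mul_propag`, `H_apply`). Since ∑ z_k is symmetric, multiplication by it commutes with every
Ť_i, so dominant x suffice. There the level sets are intervals, and everything reduces to expanding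
the sum of the z_k over one interval in the multilinear polynomials `blockFam` (`zsum_eq_famSum`).

Both sides of that expansion are symmetric in the variables of the interval and of degree at most
one in each variable. The numerator of Ť_i vanishes at z_{i+1} = -γ/δ and at z_i = -α/β, and there
Ť_i degenerates to s_i. Hence specialising the last variable to the first value, or the first
variable to the second value (homogeneously, by `slice`), turns the expansion for d + 1 variables
into the one for d, by the recursions `coef_last` and `coef_first`. So the difference of the two
sides is killed by one specialisation at each end; symmetry brings both to the same variable, and
for αδ ≠ βγ, that is q ≠ 1, a polynomial affine in this variable is then zero. The case q = 1
follows by continuity in the parameters.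

Eigenfunctions stay nonzero because G is injective, and G is injective because the elements `propag
x` span ℂ[L]. This is proved in `e_mem_gen` by producing every e^x from dominant exponents through
multiplication by the partial sums z_j + z_{j+1} + ⋯, which the block expansion controls. -/

/-! ### Simple reflections on the lattice and on the group algebra. -/

theorem e_zero {n : ℕ} : e (0 : Lat n) = 1 := rfl

theorem s_inv {n : ℕ} (i : Fin n) : (s i)⁻¹ = s i := by simp [s]

theorem act_s_act_s {n : ℕ} (i : Fin n) (x : Lat n) : act (s i) (act (s i) x) = x := by
  funext j
  simp [act, s]

theorem act_s_apply {n : ℕ} (i : Fin n) (x : Lat n) (j : Fin (n + 1)) :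
    act (s i) x j = x (s i j) := by simp [act, s_inv]

theorem s_castSucc {n : ℕ} (i : Fin n) : s i i.castSucc = i.succ := by simp [s]

theorem s_succ {n : ℕ} (i : Fin n) : s i i.succ = i.castSucc := by simp [s]

theorem s_of_ne {n : ℕ} {i : Fin n} {j : Fin (n + 1)} (h1 : j ≠ i.castSucc) (h2 : j ≠ i.succ) :
    s i j = j := Equiv.swap_apply_of_ne_of_ne h1 h2

theorem s_s {n : ℕ} (i : Fin n) (j : Fin (n + 1)) : s i (s i j) = j := by simp [s]

theorem act_add {n : ℕ} (w : Weyl n) (x y : Lat n) : act w (x + y) = act w x + act w y := rfl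

theorem act_sub {n : ℕ} (w : Weyl n) (x y : Lat n) : act w (x - y) = act w x - act w y := rfl

theorem act_neg {n : ℕ} (w : Weyl n) (x : Lat n) : act w (-x) = -act w x := rfl

theorem s_comm {n : ℕ} {i j : Fin n} (hij : i.succ < j.castSucc) : s i * s j = s j * s i := by
  have hi := Fin.castSucc_lt_succ (i := i)
  have hj := Fin.castSucc_lt_succ (i := j)
  refine Equiv.Perm.Disjoint.commute fun k => ?_
  by_cases h1 : k = i.castSucc
  · right; rw [h1, s_of_ne (hi.trans hij).ne (hi.trans (hij.trans hj)).ne]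
  · by_cases h2 : k = i.succ
    · right; rw [h2, s_of_ne hij.ne (hij.trans hj).ne]
    · left; exact s_of_ne h1 h2

theorem s_braid {n : ℕ} {i j : Fin n} (hij : i.succ = j.castSucc) :
    s j * s i * s j = s i * s j * s i := by
  have hi := Fin.castSucc_lt_succ (i := i)
  have hj := Fin.castSucc_lt_succ (i := j)
  have hik : i.castSucc < j.succ := hi.trans (hij ▸ hj)
  have hne : i.succ ≠ j.succ := by rw [hij]; exact hj.ne
  have a1 : s i i.castSucc = i.succ := s_castSucc i
  have a2 : s i i.succ = i.castSucc := s_succ i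
  have a3 : s i j.succ = j.succ := s_of_ne hik.ne' hne.symm
  have b1 : s j i.castSucc = i.castSucc := s_of_ne (hij ▸ hi.ne) hik.ne
  have b2 : s j i.succ = j.succ := by rw [hij, s_castSucc]
  have b3 : s j j.succ = i.succ := by rw [hij, s_succ]
  ext k
  simp only [Equiv.Perm.mul_apply]
  by_cases h1 : k = i.castSucc
  · simp [h1, a1, b2, b1, a3]
  · by_cases h2 : k = i.succ
    · rw [h2, b2, a3, b3, a2, b1, a1]
    · by_cases h3 : k = j.succ
      · simp [h3, a3, b3, a2, b1]
      · rw [s_of_ne h1 h2, s_of_ne (i := j) (by rwa [← hij]) h3, s_of_ne h1 h2,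
          s_of_ne (i := j) (by rwa [← hij]) h3]

theorem act_comm {n : ℕ} {i j : Fin n} (h : i.succ < j.castSucc) (x : Lat n) :
    act (s i) (act (s j) x) = act (s j) (act (s i) x) := by
  rw [← act_mul, s_comm h, act_mul]

theorem act_braid {n : ℕ} {i j : Fin n} (h : i.succ = j.castSucc) (x : Lat n) :
    act (s j) (act (s i) (act (s j) x)) = act (s i) (act (s j) (act (s i) x)) := by
  rw [← act_mul, ← act_mul, s_braid h, act_mul, act_mul]

theorem act_s_of_root_eq_zero {n : ℕ} {i : Fin n} {x : Lat n} (h : root i x = 0) :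
    act (s i) x = x := by rw [act_s, h]; simp

theorem root_act_s {n : ℕ} (i : Fin n) (x : Lat n) : root i (act (s i) x) = - root i x := by
  simp only [root, act_s_apply, s_castSucc, s_succ]; ring

/-- The action of `s_i` on `ℂ[L]`. -/
def sg {n : ℕ} (i : Fin n) : GrpAlg n →ₗ[ℂ] GrpAlg n := rightAct (s i)

@[simp]
theorem sg_e {n : ℕ} (i : Fin n) (x : Lat n) : sg i (e x) = e (act (s i) x) := by
  simp [sg, rightAct, s_inv]

@[simp]
theorem sg_one {n : ℕ} (i : Fin n) : sg i (1 : GrpAlg n) = 1 := by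
  rw [← e_zero, sg_e]; rfl

/-- To prove that a bilinear expression vanishes, it is enough to test the basis `e^x`. -/
theorem eq_of_forall_e {n : ℕ} {M : Type*} [AddCommMonoid M] [Module ℂ M]
    {A B : GrpAlg n →ₗ[ℂ] M} (h : ∀ x, A (e x) = B (e x)) (P : GrpAlg n) : A P = B P := by
  rw [hom_ext h]

@[simp]
theorem sg_mul {n : ℕ} (i : Fin n) (P Q : GrpAlg n) : sg i (P * Q) = sg i P * sg i Q := by
  refine eq_of_forall_e (A := sg i ∘ₗ LinearMap.mulRight ℂ Q)
    (B := LinearMap.mulRight ℂ (sg i Q) ∘ₗ sg i) (fun x => ?_) P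
  simp only [LinearMap.comp_apply, LinearMap.mulRight_apply]
  refine eq_of_forall_e (A := sg i ∘ₗ LinearMap.mulLeft ℂ (e x))
    (B := LinearMap.mulLeft ℂ (sg i (e x)) ∘ₗ sg i) (fun y => ?_) Q
  simp only [LinearMap.comp_apply, LinearMap.mulLeft_apply, sg_e, ← e_add, act_add]

@[simp]
theorem sg_sg {n : ℕ} (i : Fin n) (P : GrpAlg n) : sg i (sg i P) = P :=
  eq_of_forall_e (A := sg i ∘ₗ sg i) (B := LinearMap.id)
    (fun x => by simp [act_s_act_s]) P

theorem sg_comm {n : ℕ} {i j : Fin n} (h : s i * s j = s j * s i) (P : GrpAlg n) :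
    sg i (sg j P) = sg j (sg i P) :=
  eq_of_forall_e (A := sg i ∘ₗ sg j) (B := sg j ∘ₗ sg i)
    (fun x => by simp [← act_mul, h]) P

theorem sg_braid {n : ℕ} {i j : Fin n} (h : s i * s j * s i = s j * s i * s j)
    (P : GrpAlg n) : sg i (sg j (sg i P)) = sg j (sg i (sg j P)) :=
  eq_of_forall_e (A := sg i ∘ₗ sg j ∘ₗ sg i) (B := sg j ∘ₗ sg i ∘ₗ sg j)
    (fun x => by simp only [LinearMap.comp_apply, sg_e, ← act_mul, ← mul_assoc, h]) P

theorem e_v_sub_ne_zero {n : ℕ} {a b : Fin (n + 1)} (hab : a ≠ b) :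
    (e (v a) - e (v b) : GrpAlg n) ≠ 0 := by
  intro h0
  have h1 : v a = v b :=
    (AddMonoidAlgebra.single_left_inj (one_ne_zero (α := ℂ))).mp (sub_eq_zero.mp h0)
  have h2 := congrFun h1 a
  simp [v, hab] at h2

/-! ### Hecke relations of the operators Ť_i. -/

section Params

variable (α β γ δ : ℂ)

/-- The numerator `(α e^{v_a} + β) (γ e^{v_b} + δ)`. -/
def num {n : ℕ} (a b : Fin (n + 1)) : GrpAlg n :=
  (α • e (v a) + β • (1 : GrpAlg n)) * (γ • e (v b) + δ • (1 : GrpAlg n))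

/-- The division-free form of Ť_i. As ℂ[L] is a domain it determines Ť_i P, so later identities are
checked after multiplication by the denominator. -/
theorem Tcheck_spec {n : ℕ} (i : Fin n) (P : GrpAlg n) :
    (e (v i.castSucc) - e (v i.succ)) * Tcheck α β γ δ i P =
      (e (v i.castSucc) - e (v i.succ)) * sg i P +
        num α β γ δ i.castSucc i.succ * (P - sg i P) := by
  rw [sg, ← divDiff_spec]
  simp only [Tcheck, LinearMap.add_apply, LinearMap.comp_apply, LinearMap.mulLeft_apply, num]
  ring

theorem Tcheck_unique {n : ℕ} {i : Fin n} {P Q : GrpAlg n}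
    (h : (e (v i.castSucc) - e (v i.succ)) * Q =
      (e (v i.castSucc) - e (v i.succ)) * sg i P +
        num α β γ δ i.castSucc i.succ * (P - sg i P)) : Tcheck α β γ δ i P = Q :=
  mul_left_cancel₀ (e_v_sub_ne_zero (Fin.castSucc_lt_succ (i := i)).ne)
    ((Tcheck_spec α β γ δ i P).trans h.symm)

/-- Divided differences are linear over the s_i-invariants. This is why multiplication by symmetric
sums of the z_k passes through Ť_i. -/
theorem Tcheck_mul {n : ℕ} {i : Fin n} {P : GrpAlg n} (hP : sg i P = P) (Q : GrpAlg n) :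
    Tcheck α β γ δ i (P * Q) = P * Tcheck α β γ δ i Q := by
  refine Tcheck_unique α β γ δ ?_
  rw [sg_mul, hP]
  linear_combination P * Tcheck_spec α β γ δ i Q

theorem Tcheck_of_sg_eq {n : ℕ} {i : Fin n} {P : GrpAlg n} (hP : sg i P = P) :
    Tcheck α β γ δ i P = P := by
  refine Tcheck_unique α β γ δ ?_
  rw [hP]; ring

theorem sg_num {n : ℕ} (i : Fin n) (a b : Fin (n + 1)) :
    sg i (num α β γ δ a b) = num α β γ δ (s i a) (s i b) := by
  simp [num, act_v]

/-- Let N be the fraction in Ť_i. Then N + s_i N = αδ - βγ = 1 - q, so s_i exchanges the two terms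
of (N + q) P + (1 - N) P.s_i. -/
theorem sg_Tcheck_add {n : ℕ} (i : Fin n) (P : GrpAlg n) :
    sg i (Tcheck α β γ δ i P + qpar α β γ δ • P) =
      Tcheck α β γ δ i P + qpar α β γ δ • P := by
  refine mul_left_cancel₀ (e_v_sub_ne_zero (Fin.castSucc_lt_succ (i := i)).ne) ?_
  have h := Tcheck_spec α β γ δ i P
  have h' := congrArg (sg i) h
  simp only [sg_mul, map_sub, map_add, sg_e, act_v, s_castSucc, s_succ, sg_sg, sg_num] at h'
  simp only [map_add, map_smul]
  simp only [num, qpar, Algebra.smul_def, map_add, map_sub, map_mul, map_one] at *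
  linear_combination - h' - h

theorem Tcheck_Tcheck {n : ℕ} (i : Fin n) (P : GrpAlg n) :
    Tcheck α β γ δ i (Tcheck α β γ δ i P) =
      (1 - qpar α β γ δ) • Tcheck α β γ δ i P + qpar α β γ δ • P := by
  have h := Tcheck_of_sg_eq α β γ δ (sg_Tcheck_add α β γ δ i P)
  rw [map_add, map_smul] at h
  rw [sub_smul, one_smul, eq_sub_of_add_eq h]
  abel

/-- The braid relation with the six images of P under 𝔖₃ treated as independent unknowns. Only the
reflection rule for N (`h1`, `h2`) and one quadratic relation between its three values (`h3`) are
needed. -/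
theorem braid_identity {K : Type*} [Field K] (a b c d x y z p p1 p2 p12 p21 p0 : K)
    (hxy : x - y ≠ 0) (hyz : y - z ≠ 0) (hxz : x - z ≠ 0) :
    let N : K → K → K := fun x y => (a * x + b) * (c * y + d) / (x - y)
    let t : K → K → K → K := fun b P Q => Q + b * (P - Q)
    t (N y z) (t (N x y) (t (N y z) p p2) (t (N x z) p1 p12))
      (t (N x z) (t (N z y) p2 p) (t (N x y) p21 p0)) =
    t (N x y) (t (N y z) (t (N x y) p p1) (t (N x z) p2 p21))
      (t (N x z) (t (N y x) p1 p) (t (N y z) p12 p0)) := by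
  intro N t
  have h1 : N y x = (a * d - b * c) - N x y := by
    simp only [N]
    have : y - x ≠ 0 := by rw [← neg_sub]; exact neg_ne_zero.mpr hxy
    field_simp; ring
  have h2 : N z y = (a * d - b * c) - N y z := by
    simp only [N]
    have : z - y ≠ 0 := by rw [← neg_sub]; exact neg_ne_zero.mpr hyz
    field_simp; ring
  have h3 : N x y * N y z = N x z * (N x y + N y z - (a * d - b * c)) := by
    simp only [N]
    field_simp; ring
  rw [h1, h2]
  generalize N x y = B1 at *
  generalize N y z = B2 at *
  generalize N x z = B3 at *
  simp only [t]
  generalize a * d - b * c = k at *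
  linear_combination ((B2 - B1) * p - (1 - B1) * p1 + (1 - B2) * p2) * h3

theorem mul_eq_of_cross {K : Type*} [Field K] {x y R P Q N : K} (hxy : x - y ≠ 0)
    (h : (x - y) * R = (x - y) * Q + N * (P - Q)) : R = Q + N / (x - y) * (P - Q) := by
  field_simp
  linear_combination h

theorem Tcheck_comm {n : ℕ} {i j : Fin n} (hij : i.succ < j.castSucc) (P : GrpAlg n) :
    Tcheck α β γ δ i (Tcheck α β γ δ j P) = Tcheck α β γ δ j (Tcheck α β γ δ i P) := by
  have hi := Fin.castSucc_lt_succ (i := i)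
  have hj := Fin.castSucc_lt_succ (i := j)
  have a1 : s i j.castSucc = j.castSucc := s_of_ne (hi.trans hij).ne' hij.ne'
  have a2 : s i j.succ = j.succ := s_of_ne (hi.trans (hij.trans hj)).ne' (hij.trans hj).ne'
  have a3 : s j i.castSucc = i.castSucc := s_of_ne (hi.trans hij).ne (hi.trans (hij.trans hj)).ne
  have a4 : s j i.succ = i.succ := s_of_ne hij.ne (hij.trans hj).ne
  have hs := s_comm hij
  refine Tcheck_unique α β γ δ ?_
  refine mul_left_cancel₀ (e_v_sub_ne_zero hj.ne) ?_
  have c1 := Tcheck_spec α β γ δ j P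
  have c2 := congrArg (sg i) c1
  have c3 := Tcheck_spec α β γ δ i P
  have c4 := congrArg (sg j) c3
  have c5 := Tcheck_spec α β γ δ j (Tcheck α β γ δ i P)
  simp only [sg_mul, map_sub, map_add, sg_e, act_v, a1, a2, a3, a4, sg_num, sg_comm hs]
    at c2 c4
  linear_combination (e (v i.castSucc) - e (v i.succ)) * c5 +
    num α β γ δ j.castSucc j.succ * c3 - num α β γ δ i.castSucc i.succ * c1 +
    (e (v j.castSucc) - e (v j.succ)) * c4 - num α β γ δ j.castSucc j.succ * c4 -
    (e (v i.castSucc) - e (v i.succ)) * c2 + num α β γ δ i.castSucc i.succ * c2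

theorem Tcheck_braid {n : ℕ} {i j : Fin n} (hij : i.succ = j.castSucc) (P : GrpAlg n) :
    Tcheck α β γ δ j (Tcheck α β γ δ i (Tcheck α β γ δ j P)) =
      Tcheck α β γ δ i (Tcheck α β γ δ j (Tcheck α β γ δ i P)) := by
  have hi := Fin.castSucc_lt_succ (i := i)
  have hj := Fin.castSucc_lt_succ (i := j)
  have hik : i.castSucc < j.succ := hi.trans (hij ▸ hj)
  have hne : i.succ ≠ j.succ := by rw [hij]; exact hj.ne
  have a1 : s i i.castSucc = i.succ := s_castSucc i
  have a2 : s i i.succ = i.castSucc := s_succ i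
  have a3 : s i j.succ = j.succ := s_of_ne hik.ne' hne.symm
  have b1 : s j i.castSucc = i.castSucc := s_of_ne (hij ▸ hi.ne) hik.ne
  have b2 : s j i.succ = j.succ := by rw [hij, s_castSucc]
  have b3 : s j j.succ = i.succ := by rw [hij, s_succ]
  have hs := s_braid hij
  -- In the fraction field each application of Ť_i, or its image under reflections, can be solved
  -- for explicitly; the images of P then enter only as values.
  let K := FractionRing (GrpAlg n)
  let f := algebraMap (GrpAlg n) K
  have hf : Function.Injective f := IsFractionRing.injective _ _
  have hxy : f (e (v i.castSucc)) - f (e (v i.succ)) ≠ 0 := by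
    rw [← map_sub]; exact (map_ne_zero_iff f hf).mpr (e_v_sub_ne_zero hi.ne)
  have hyz : f (e (v i.succ)) - f (e (v j.succ)) ≠ 0 := by
    rw [← map_sub]; exact (map_ne_zero_iff f hf).mpr (e_v_sub_ne_zero hne)
  have hxz : f (e (v i.castSucc)) - f (e (v j.succ)) ≠ 0 := by
    rw [← map_sub]; exact (map_ne_zero_iff f hf).mpr (e_v_sub_ne_zero hik.ne)
  have hyx : f (e (v i.succ)) - f (e (v i.castSucc)) ≠ 0 := by
    rw [← neg_sub]; exact neg_ne_zero.mpr hxy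
  have hzy : f (e (v j.succ)) - f (e (v i.succ)) ≠ 0 := by
    rw [← neg_sub]; exact neg_ne_zero.mpr hyz
  have hnum : ∀ x y, f (num α β γ δ x y) = (algebraMap ℂ K α * f (e (v x)) + algebraMap ℂ K β) *
      (algebraMap ℂ K γ * f (e (v y)) + algebraMap ℂ K δ) := by
    intro x y
    have h : ∀ c : ℂ, f (algebraMap ℂ (GrpAlg n) c) = algebraMap ℂ K c := fun c =>
      (IsScalarTower.algebraMap_apply ℂ (GrpAlg n) K c).symm
    simp only [num, Algebra.smul_def, map_mul, map_add, mul_one, h]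
  have key := braid_identity (algebraMap ℂ K α) (algebraMap ℂ K β) (algebraMap ℂ K γ)
    (algebraMap ℂ K δ) (f (e (v i.castSucc))) (f (e (v i.succ))) (f (e (v j.succ)))
    (f P) (f (sg i P)) (f (sg j P)) (f (sg i (sg j P))) (f (sg j (sg i P)))
    (f (sg j (sg i (sg j P)))) hxy hyz hxz
  have step : ∀ (a b : Fin (n + 1)) (R P Q : GrpAlg n), f (e (v a)) - f (e (v b)) ≠ 0 →
      (e (v a) - e (v b)) * R = (e (v a) - e (v b)) * Q + num α β γ δ a b * (P - Q) →
      f R = f Q + (algebraMap ℂ K α * f (e (v a)) + algebraMap ℂ K β) *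
        (algebraMap ℂ K γ * f (e (v b)) + algebraMap ℂ K δ) / (f (e (v a)) - f (e (v b))) *
          (f P - f Q) := by
    intro a b R P Q hab h
    refine mul_eq_of_cross hab ?_
    rw [← hnum]
    simpa only [map_mul, map_add, map_sub] using congrArg f h
  have Ti := Tcheck_spec α β γ δ i
  have Tj := Tcheck_spec α β γ δ j
  rw [← hij] at Tj
  have sTi : ∀ Q, _ := fun Q => congrArg (sg i) (Ti Q)
  have sTj : ∀ Q, _ := fun Q => congrArg (sg i) (Tj Q)
  have tTi : ∀ Q, _ := fun Q => congrArg (sg j) (Ti Q)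
  have tTj : ∀ Q, _ := fun Q => congrArg (sg j) (Tj Q)
  have stTi : ∀ Q, _ := fun Q => congrArg (sg i) (tTi Q)
  have tsTj : ∀ Q, _ := fun Q => congrArg (sg j) (sTj Q)
  simp only [sg_mul, map_sub, map_add, sg_e, act_v, a1, a2, a3, b1, b2, b3, sg_num, sg_sg]
    at sTi sTj tTi tTj stTi tsTj
  apply hf
  rw [step _ _ _ _ _ hyz (Tj (Tcheck α β γ δ i (Tcheck α β γ δ j P))),
    step _ _ _ _ _ hxy (Ti (Tcheck α β γ δ j P)), step _ _ _ _ _ hxz (tTi (Tcheck α β γ δ j P)),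
    step _ _ _ _ _ hyz (Tj P), step _ _ _ _ _ hxz (sTj P), step _ _ _ _ _ hzy (tTj P),
    step _ _ _ _ _ hxy (tsTj P), step _ _ _ _ _ hxy (Ti (Tcheck α β γ δ j (Tcheck α β γ δ i P))),
    step _ _ _ _ _ hyz (Tj (Tcheck α β γ δ i P)), step _ _ _ _ _ hxz (sTj (Tcheck α β γ δ i P)),
    step _ _ _ _ _ hxy (Ti P), step _ _ _ _ _ hxz (tTi P), step _ _ _ _ _ hyx (sTi P),
    step _ _ _ _ _ hyz (stTi P), sg_braid hs.symm P]
  exact key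

end Params

/-! ### Sorting lattice points and counting inversions. -/

theorem dominant_iff_antitone {n : ℕ} {x : Lat n} : Dominant x ↔ Antitone x := by
  rw [Fin.antitone_iff_succ_le]
  simp only [Dominant, root, sub_nonneg]

/-- The inversions of `x`, that is the pairs of coordinates in increasing order. -/
def invSet {n : ℕ} (x : Lat n) : Finset (Fin (n + 1) × Fin (n + 1)) :=
  Finset.univ.filter fun p => p.1 < p.2 ∧ x p.1 < x p.2

/-- The number of inversions of `x`. -/
def inv {n : ℕ} (x : Lat n) : ℕ := (invSet x).card

theorem s_val {n : ℕ} (i : Fin n) (p : Fin (n + 1)) :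
    (s i p).val = if p.val = i.val then i.val + 1 else if p.val = i.val + 1 then i.val
      else p.val := by
  by_cases h1 : p = i.castSucc
  · subst h1; simp [s_castSucc]
  · by_cases h2 : p = i.succ
    · subst h2; simp [s_succ]
    · rw [s_of_ne h1 h2]
      have h1' : p.val ≠ i.val := fun h => h1 (Fin.ext h)
      have h2' : p.val ≠ i.val + 1 := fun h => h2 (Fin.ext h)
      simp [h1', h2']

/-- Applying s_i to both indices maps the inversions of s_i x bijectively onto those of x other than
the pair of neighbours itself. -/
theorem inv_act_s {n : ℕ} {i : Fin n} {x : Lat n} (h : root i x < 0) :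
    inv (act (s i) x) + 1 = inv x := by
  have hx : x i.castSucc < x i.succ := by simpa [root] using h
  have hmem : (i.castSucc, i.succ) ∈ invSet x := by
    simp [invSet, hx]
  have key : (invSet (act (s i) x)).map ((s i).prodCongr (s i)).toEmbedding =
      (invSet x).erase (i.castSucc, i.succ) := by
    ext ⟨p, q⟩
    rw [Finset.mem_map_equiv]
    have hinv : ((s i).prodCongr (s i)).symm (p, q) = (s i p, s i q) := by
      rw [Equiv.symm_apply_eq]
      simp [s_s]
    rw [hinv]
    simp only [invSet, Finset.mem_erase, Finset.mem_filter, Finset.mem_univ, true_and,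
      act_s_apply, s_s, Ne, Prod.mk.injEq]
    by_cases hpq : p = i.castSucc ∧ q = i.succ
    · obtain ⟨rfl, rfl⟩ := hpq
      simp [s_castSucc, s_succ, (Fin.castSucc_lt_succ (i := i)).le.not_gt]
    · by_cases hqp : p = i.succ ∧ q = i.castSucc
      · obtain ⟨rfl, rfl⟩ := hqp
        simp [hx.not_gt]
      · have horder : s i p < s i q ↔ p < q := by
          rw [Fin.lt_def, Fin.lt_def, s_val, s_val]
          rw [Fin.ext_iff, Fin.ext_iff] at hpq hqp
          simp only [Fin.val_castSucc, Fin.val_succ] at hpq hqp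
          split_ifs <;> omega
        rw [horder]
        tauto
  rw [inv, inv, ← Finset.card_map ((s i).prodCongr (s i)).toEmbedding, key,
    Finset.card_erase_add_one hmem]

theorem inv_act_s_lt {n : ℕ} {i : Fin n} {x : Lat n} (h : root i x < 0) :
    inv (act (s i) x) < inv x := by
  have := inv_act_s h
  omega

theorem inv_act_s_of_pos {n : ℕ} {i : Fin n} {x : Lat n} (h : 0 < root i x) :
    inv (act (s i) x) = inv x + 1 := by
  have h' : root i (act (s i) x) < 0 := by rw [root_act_s]; omega
  rw [← inv_act_s h', act_s_act_s]

theorem Dominant.inv_eq_zero {n : ℕ} {x : Lat n} (h : Dominant x) : inv x = 0 := by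
  rw [inv, Finset.card_eq_zero, invSet, Finset.filter_eq_empty_iff]
  rintro ⟨p, q⟩ - ⟨h1, h2⟩
  exact absurd (dominant_iff_antitone.mp h h1.le) (not_le.mpr h2)

theorem exists_root_neg {n : ℕ} {x : Lat n} (h : ¬ Dominant x) : ∃ i, root i x < 0 := by
  simpa [Dominant] using h

/-- Induction along the sorting of lattice points. -/
theorem sort_induction {n : ℕ} {motive : Lat n → Prop}
    (dom : ∀ x, Dominant x → motive x)
    (step : ∀ x, (∀ y, inv y < inv x → motive y) → (∃ i, root i x < 0) → motive x)
    (x : Lat n) : motive x := by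
  induction hx : inv x using Nat.strong_induction_on generalizing x with
  | _ m ih =>
    by_cases h : Dominant x
    · exact dom x h
    · exact step x (fun y hy => ih _ (hx ▸ hy) _ rfl) (exists_root_neg h)

/-- The end of the path which starts at `x` and applies the reflections in the word `m`. -/
def run {n : ℕ} : Lat n → List (Fin n) → Lat n
  | x, [] => x
  | x, i :: m => run (act (s i) x) m

/-- The word `m` sorts `x`, exchanging at each step two neighbours in increasing order. -/
def Strict {n : ℕ} : Lat n → List (Fin n) → Prop
  | x, [] => Dominant x
  | x, i :: m => root i x < 0 ∧ Strict (act (s i) x) m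

theorem run_eq_act {n : ℕ} (m : List (Fin n)) (x : Lat n) :
    run x m = act (wordProd m.reverse) x := by
  induction m generalizing x with
  | nil => rfl
  | cons i m ih =>
    rw [run, ih, ← act_mul]
    simp [wordProd]

theorem exists_strict {n : ℕ} (x : Lat n) : ∃ m, Strict x m := by
  induction x using sort_induction with
  | dom x hx => exact ⟨[], hx⟩
  | step x ih h =>
    obtain ⟨i, hi⟩ := h
    obtain ⟨m, hm⟩ := ih _ (inv_act_s_lt hi)
    exact ⟨i :: m, hi, hm⟩

theorem Strict.dominant_run {n : ℕ} {m : List (Fin n)} {x : Lat n} (h : Strict x m) :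
    Dominant (run x m) := by
  induction m generalizing x with
  | nil => exact h
  | cons i m ih => exact ih h.2

theorem Strict.length_eq {n : ℕ} {m : List (Fin n)} {x : Lat n} (h : Strict x m) :
    m.length = inv x := by
  induction m generalizing x with
  | nil => exact (Dominant.inv_eq_zero h).symm
  | cons i m ih => rw [List.length_cons, ih h.2, inv_act_s h.1]

/-- A simple reflection removes at most one inversion, and a dominant point has none. -/
theorem inv_le_length {n : ℕ} {m : List (Fin n)} {x : Lat n} (h : Dominant (run x m)) :
    inv x ≤ m.length := by
  induction m generalizing x with
  | nil => exact (Dominant.inv_eq_zero h).le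
  | cons i m ih =>
    have h1 := ih h
    rw [List.length_cons]
    rcases lt_trichotomy (root i x) 0 with hr | hr | hr
    · have := inv_act_s hr
      omega
    · rw [act_s_of_root_eq_zero hr] at h1
      omega
    · have := inv_act_s_of_pos hr
      omega

theorem strict_of_length_le {n : ℕ} {m : List (Fin n)} {x : Lat n} (h : Dominant (run x m))
    (hm : m.length ≤ inv x) : Strict x m := by
  induction m generalizing x with
  | nil => exact h
  | cons i m ih =>
    have h1 := inv_le_length (x := act (s i) x) (m := m) h
    rw [List.length_cons] at hm
    have hr : root i x < 0 := by
      rcases lt_trichotomy (root i x) 0 with hr | hr | hr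
      · exact hr
      · rw [act_s_of_root_eq_zero hr] at h1
        omega
      · have := inv_act_s_of_pos hr
        omega
    refine ⟨hr, ih h ?_⟩
    have := inv_act_s hr
    omega

/-- Some strict word sorts x in `inv x` steps, so a shortest sorting element is no longer than that.
A sorting word of such length cannot waste a step: each letter must remove an inversion. -/
theorem strict_of_isReduced {n : ℕ} {x : Lat n} {l : List (Fin n)} (hl : IsReduced l (wmin x)) :
    Strict x l.reverse := by
  obtain ⟨hdom, hmin⟩ : IsShortest x (wmin x) := Classical.choose_spec (exists_isShortest x)
  refine strict_of_length_le ?_ ?_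
  · rwa [run_eq_act, List.reverse_reverse, hl.1]
  · obtain ⟨m, hm⟩ := exists_strict x
    rw [List.length_reverse, hl.2, ← hm.length_eq]
    have h1 := hmin (wordProd m.reverse) (by rw [← run_eq_act]; exact hm.dominant_run)
    refine h1.trans (Nat.sInf_le ⟨m.reverse, rfl, ?_⟩)
    simp

/-! ### The elements of ℂ[L] that represent propagation. -/

section Params

variable (α β γ δ : ℂ)

/-- The image of `e^y` at the end `y` of a sorting path under the operators `Ť_i` met on the
way back. -/
def alongPath {n : ℕ} : Lat n → List (Fin n) → GrpAlg n
  | x, [] => e x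
  | x, i :: m => Tcheck α β γ δ i (alongPath (act (s i) x) m)

theorem pairing_e {n : ℕ} (x : Lat n) (f : Fun n) : pairing (e x) f = f x := by
  simp [pairing]

theorem pairing_alongPath {n : ℕ} (m : List (Fin n)) (x : Lat n) (f : Fun n) :
    pairing (alongPath α β γ δ x m) f = (m.reverse.map (That α β γ δ)).prod f (run x m) := by
  induction m generalizing x f with
  | nil => simp [alongPath, run, pairing_e]
  | cons i m ih =>
    rw [alongPath, pairing_transpose, ih]
    simp [run, That]

theorem root_act_of_lt {n : ℕ} {i j : Fin n} (h : i.succ < j.castSucc) (x : Lat n) :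
    root i (act (s j) x) = root i x := by
  have hi := Fin.castSucc_lt_succ (i := i)
  have hj := Fin.castSucc_lt_succ (i := j)
  simp only [root, act_s_apply, s_of_ne h.ne (h.trans hj).ne,
    s_of_ne (hi.trans h).ne (hi.trans (h.trans hj)).ne]

theorem root_act_of_gt {n : ℕ} {i j : Fin n} (h : j.succ < i.castSucc) (x : Lat n) :
    root i (act (s j) x) = root i x := by
  have hi := Fin.castSucc_lt_succ (i := i)
  have hj := Fin.castSucc_lt_succ (i := j)
  simp only [root, act_s_apply, s_of_ne (hj.trans h).ne' h.ne',
    s_of_ne (hj.trans (h.trans hi)).ne' (h.trans hi).ne']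

theorem root_act_succ {n : ℕ} {i j : Fin n} (h : i.succ = j.castSucc) (x : Lat n) :
    root i (act (s j) x) = root i x + root j x := by
  have h1 : i.castSucc < j.castSucc := h ▸ Fin.castSucc_lt_succ
  have hj := Fin.castSucc_lt_succ (i := j)
  simp only [root, act_s_apply, s_of_ne h1.ne (h1.trans hj).ne, h, s_castSucc]
  ring

theorem root_act_pred {n : ℕ} {i j : Fin n} (h : i.succ = j.castSucc) (x : Lat n) :
    root j (act (s i) x) = root i x + root j x := by
  have h1 : i.succ < j.succ := h ▸ Fin.castSucc_lt_succ
  have hi := Fin.castSucc_lt_succ (i := i)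
  simp only [root, act_s_apply, s_of_ne (hi.trans h1).ne' h1.ne', ← h, s_succ]
  ring

theorem trichotomy {n : ℕ} {motive : Fin n → Fin n → Prop} (symm : ∀ i j, motive i j → motive j i)
    (eq : ∀ i, motive i i) (far : ∀ i j : Fin n, i.succ < j.castSucc → motive i j)
    (near : ∀ i j : Fin n, i.succ = j.castSucc → motive i j) (i j : Fin n) : motive i j := by
  have key : ∀ i j : Fin n, i < j → motive i j := by
    intro i j hij
    have hle : i.succ ≤ j.castSucc := by
      rw [Fin.le_def, Fin.val_succ, Fin.val_castSucc]
      exact hij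
    rcases hle.lt_or_eq with h | h
    · exact far i j h
    · exact near i j h
  rcases lt_trichotomy i j with h | h | h
  · exact key i j h
  · exact h ▸ eq i
  · exact symm _ _ (key j i h)

/-- A diamond argument by induction on inversions. If the words start with different letters i and
j, both tails may be replaced by words that lead to a common point, through s_i s_j = s_j s_i or the
braid relation; the operators Ť satisfy the same relation. -/
theorem alongPath_eq {n : ℕ} {x : Lat n} {m m' : List (Fin n)} (h : Strict x m)
    (h' : Strict x m') : alongPath α β γ δ x m = alongPath α β γ δ x m' := by
  suffices H : ∀ x : Lat n, ∀ m m', Strict x m → Strict x m' →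
      alongPath α β γ δ x m = alongPath α β γ δ x m' from H x m m' h h'
  clear h h' x m m'
  intro x
  induction x using sort_induction with
  | dom x hx =>
    intro m m' h h'
    have h1 := h.length_eq
    have h2 := h'.length_eq
    rw [hx.inv_eq_zero, List.length_eq_zero_iff] at h1 h2
    rw [h1, h2]
  | step x ih hx =>
    intro m m' h h'
    have hne : inv x ≠ 0 := by
      obtain ⟨i, hi⟩ := hx
      have := inv_act_s hi
      omega
    obtain _ | ⟨i, m⟩ := m
    · exact absurd h.length_eq.symm hne
    obtain _ | ⟨j, m'⟩ := m'
    · exact absurd h'.length_eq.symm hne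
    suffices H : ∀ i j : Fin n, root i x < 0 → root j x < 0 → ∀ m m',
        Strict (act (s i) x) m → Strict (act (s j) x) m' →
        alongPath α β γ δ x (i :: m) = alongPath α β γ δ x (j :: m') from
      H i j h.1 h'.1 m m' h.2 h'.2
    refine trichotomy ?_ ?_ ?_ ?_
    · intro i j H hi hj m m' hm hm'
      exact (H hj hi m' m hm' hm).symm
    · intro i hi _ m m' hm hm'
      rw [alongPath, alongPath, ih _ (inv_act_s_lt hi) m m' hm hm']
    · intro i j hij hi hj m m' hm hm'
      obtain ⟨l, hl⟩ := exists_strict (act (s i) (act (s j) x))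
      have e1 := ih _ (inv_act_s_lt hj) m' (i :: l) hm' ⟨by rwa [root_act_of_lt hij], hl⟩
      have e2 := ih _ (inv_act_s_lt hi) m (j :: l) hm ⟨by rwa [root_act_of_gt hij], by rwa [← act_comm hij]⟩
      simp only [alongPath] at e1 e2 ⊢
      rw [e1, e2, Tcheck_comm α β γ δ hij, act_comm hij]
    · intro i j hij hi hj m m' hm hm'
      obtain ⟨l, hl⟩ := exists_strict (act (s i) (act (s j) (act (s i) x)))
      have r1 : root i (act (s j) x) < 0 := by rw [root_act_succ hij]; omega
      have r2 : root j (act (s i) x) < 0 := by rw [root_act_pred hij]; omega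
      have r3 : root j (act (s i) (act (s j) x)) < 0 := by
        rw [root_act_pred hij, root_act_succ hij, root_act_s]; omega
      have r4 : root i (act (s j) (act (s i) x)) < 0 := by
        rw [root_act_succ hij, root_act_pred hij, root_act_s]; omega
      have e1 := ih _ (inv_act_s_lt hj) m' (i :: j :: l) hm' ⟨r1, r3, by rwa [act_braid hij]⟩
      have e2 := ih _ (inv_act_s_lt hi) m (j :: i :: l) hm ⟨r2, r4, hl⟩
      simp only [alongPath] at e1 e2 ⊢
      rw [e1, e2, ← Tcheck_braid α β γ δ hij, act_braid hij]

/-- A strict sorting word of `x`. -/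
def sortWord {n : ℕ} (x : Lat n) : List (Fin n) := Classical.choose (exists_strict x)

theorem strict_sortWord {n : ℕ} (x : Lat n) : Strict x (sortWord x) :=
  Classical.choose_spec (exists_strict x)

/-- The element of `ℂ[L]` whose pairing with `f` is `G f x`. -/
def propag {n : ℕ} (x : Lat n) : GrpAlg n := alongPath α β γ δ x (sortWord x)

theorem propag_eq {n : ℕ} {x : Lat n} {m : List (Fin n)} (h : Strict x m) :
    propag α β γ δ x = alongPath α β γ δ x m :=
  alongPath_eq α β γ δ (strict_sortWord x) h

theorem G_apply {n : ℕ} (f : Fun n) (x : Lat n) :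
    G α β γ δ n f x = pairing (propag α β γ δ x) f := by
  have h := Classical.choose_spec (exists_isReduced (wmin x))
  rw [propag_eq α β γ δ (strict_of_isReduced h), pairing_alongPath, run_eq_act,
    List.reverse_reverse, h.1]
  rfl

theorem propag_of_dominant {n : ℕ} {x : Lat n} (h : Dominant x) : propag α β γ δ x = e x :=
  propag_eq α β γ δ (m := []) h

theorem propag_of_root_neg {n : ℕ} {i : Fin n} {x : Lat n} (h : root i x < 0) :
    propag α β γ δ x = Tcheck α β γ δ i (propag α β γ δ (act (s i) x)) :=
  propag_eq α β γ δ (m := i :: sortWord (act (s i) x)) ⟨h, strict_sortWord _⟩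

/-- The invariance is evident at dominant points. Elsewhere some j ≠ i is an ascent; the commutation
or braid relation moves Ť_i past the first sorting steps, where it becomes an operator attached to
equal neighbours of a point with fewer inversions. -/
theorem Tcheck_propag_of_root_eq_zero {n : ℕ} {i : Fin n} {x : Lat n} (h : root i x = 0) :
    Tcheck α β γ δ i (propag α β γ δ x) = propag α β γ δ x := by
  induction x using sort_induction generalizing i with
  | dom x hx =>
    rw [propag_of_dominant α β γ δ hx]
    refine Tcheck_of_sg_eq α β γ δ ?_
    rw [sg_e, act_s_of_root_eq_zero h]
  | step x ih hx =>
    obtain ⟨j, hj⟩ := hx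
    revert h hj
    suffices H : ∀ i j : Fin n, (root i x = 0 → root j x < 0 →
        Tcheck α β γ δ i (propag α β γ δ x) = propag α β γ δ x) ∧
        (root j x = 0 → root i x < 0 →
        Tcheck α β γ δ j (propag α β γ δ x) = propag α β γ δ x) from (H i j).1
    refine trichotomy ?_ ?_ ?_ ?_
    · intro i j h
      exact ⟨h.2, h.1⟩
    · intro i
      constructor <;> intro h1 h2 <;> omega
    · intro i j hij
      constructor
      · intro h hj
        rw [propag_of_root_neg α β γ δ hj, Tcheck_comm α β γ δ hij,
          ih _ (inv_act_s_lt hj) (by rwa [root_act_of_lt hij])]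
      · intro h hj
        rw [propag_of_root_neg α β γ δ hj, ← Tcheck_comm α β γ δ hij,
          ih _ (inv_act_s_lt hj) (by rwa [root_act_of_gt hij])]
    · intro i j hij
      constructor
      · intro h hj
        have r1 : root i (act (s j) x) < 0 := by rw [root_act_succ hij]; omega
        rw [propag_of_root_neg α β γ δ hj, propag_of_root_neg α β γ δ r1,
          ← Tcheck_braid α β γ δ hij]
        rw [ih _ ((inv_act_s_lt r1).trans (inv_act_s_lt hj))]
        rw [root_act_pred hij, root_act_succ hij, root_act_s]
        omega
      · intro h hi
        have r1 : root j (act (s i) x) < 0 := by rw [root_act_pred hij]; omega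
        rw [propag_of_root_neg α β γ δ hi, propag_of_root_neg α β γ δ r1,
          Tcheck_braid α β γ δ hij]
        rw [ih _ ((inv_act_s_lt r1).trans (inv_act_s_lt hi))]
        rw [root_act_succ hij, root_act_pred hij, root_act_s]
        omega

theorem Tcheck_propag {n : ℕ} {i : Fin n} {x : Lat n} (h : 0 ≤ root i x) :
    Tcheck α β γ δ i (propag α β γ δ x) = propag α β γ δ (act (s i) x) := by
  rcases h.eq_or_lt with h | h
  · rw [Tcheck_propag_of_root_eq_zero α β γ δ h.symm, act_s_of_root_eq_zero h.symm]
  · rw [propag_of_root_neg α β γ δ (i := i) (x := act (s i) x) (by rw [root_act_s]; omega),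
      act_s_act_s]

end Params

/-! ### Fixed elements of Ť_i, and its action on multilinear elements. -/

section Params

variable (α β γ δ : ℂ)

/-- Comparing coefficients would force αδ = 1, βγ = -1 and αγ = βδ = 0, contrary to (αδ)(βγ) =
(αγ)(βδ). -/
theorem num_ne {n : ℕ} {a b : Fin (n + 1)} (hab : a ≠ b) :
    num α β γ δ a b ≠ e (v a) - e (v b) := by
  intro h
  have key : ∀ f : Fun n, α * γ * f (v a + v b) + α * δ * f (v a) + β * γ * f (v b) +
      β * δ * f 0 = f (v a) - f (v b) := by
    intro f
    have h1 : num α β γ δ a b = (α * γ) • e (v a + v b) + (α * δ) • e (v a) +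
        (β * γ) • e (v b) + (β * δ) • e 0 := by
      simp only [num, e_add, e_zero, Algebra.smul_def, map_mul]
      ring
    have h2 := congrArg (extend f) (h1.symm.trans h)
    simpa only [map_add, map_sub, map_smul, extend_e, smul_eq_mul] using h2
  have hva : ∀ c : Fin (n + 1), (v c : Lat n) ≠ 0 := by
    intro c h0
    simpa [v] using congrFun h0 c
  have hvab : (v a : Lat n) ≠ v b := by
    intro h0
    simpa [v, hab] using congrFun h0 a
  have h1 := key (Pi.single (v a + v b) 1)
  have h2 := key (Pi.single (v a) 1)
  have h3 := key (Pi.single (v b) 1)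
  have h4 := key (Pi.single 0 1)
  have hs : v a + v b ≠ (0 : Lat n) := by
    intro h0
    simpa [v, hab] using congrFun h0 a
  simp [hva, hva _ |>.symm, hvab, hvab.symm, hs, hs.symm] at h1 h2 h3 h4
  have : (α * δ) * (β * γ) = 0 := by
    rcases h1 with h | h <;> rw [h] <;> ring
  rw [h2, h3] at this
  norm_num at this

/-- Ť_i P - P is P.s_i - P times 1 - N, where N is the fraction in Ť_i, and N ≠ 1 by `num_ne`. -/
theorem sg_of_Tcheck_eq {n : ℕ} {i : Fin n} {P : GrpAlg n} (h : Tcheck α β γ δ i P = P) :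
    sg i P = P := by
  have h1 := Tcheck_spec α β γ δ i P
  rw [h] at h1
  have h2 : (num α β γ δ i.castSucc i.succ - (e (v i.castSucc) - e (v i.succ))) *
      (P - sg i P) = 0 := by linear_combination -h1
  rcases mul_eq_zero.mp h2 with h3 | h3
  · exact absurd (sub_eq_zero.mp h3) (num_ne α β γ δ (Fin.castSucc_lt_succ (i := i)).ne)
  · exact (sub_eq_zero.mp h3).symm

/-! ### Multilinear elements -/

/-- In the z-variables the result is again of degree at most one in each variable; with linearity
over invariants this makes `cube` stable under Ť_i. -/
theorem Tcheck_z_succ {n : ℕ} (i : Fin n) :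
    Tcheck α β γ δ i (e (-v i.succ)) = (α * γ) • 1 + (1 + β * γ) • e (-v i.castSucc) +
      (α * δ) • e (-v i.succ) + (β * δ) • (e (-v i.castSucc) * e (-v i.succ)) := by
  refine Tcheck_unique α β γ δ ?_
  have h1 : e (v i.castSucc) * e (-v i.castSucc) = (1 : GrpAlg n) := by
    rw [← e_add, add_neg_cancel, e_zero]
  have h2 : e (v i.succ) * e (-v i.succ) = (1 : GrpAlg n) := by
    rw [← e_add, add_neg_cancel, e_zero]
  rw [sg_e, act_neg, act_v, s_succ]
  simp only [num, Algebra.smul_def, map_mul, map_add, map_one]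
  generalize e (v i.castSucc) = x at *
  generalize e (v i.succ) = y at *
  generalize e (-v i.castSucc) = x' at *
  generalize e (-v i.succ) = y' at *
  generalize algebraMap ℂ (GrpAlg n) α = a at *
  generalize algebraMap ℂ (GrpAlg n) β = b at *
  generalize algebraMap ℂ (GrpAlg n) γ = c at *
  generalize algebraMap ℂ (GrpAlg n) δ = d at *
  linear_combination ((a * x + b) * (c * y + d) * y' -
    (x - y) * (a * c * y * y' + a * d * y')) * h1 -
    ((a * x + b) * (c * y + d) * x' + (x - y) * (a * c + b * c * x')) * h2

theorem Tcheck_z_castSucc {n : ℕ} (i : Fin n) :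
    Tcheck α β γ δ i (e (-v i.castSucc)) = e (-v i.castSucc) + e (-v i.succ) -
      ((α * γ) • 1 + (1 + β * γ) • e (-v i.castSucc) +
      (α * δ) • e (-v i.succ) + (β * δ) • (e (-v i.castSucc) * e (-v i.succ))) := by
  have h : Tcheck α β γ δ i (e (-v i.castSucc) + e (-v i.succ)) =
      e (-v i.castSucc) + e (-v i.succ) := by
    refine Tcheck_of_sg_eq α β γ δ ?_
    rw [map_add, sg_e, sg_e, act_neg, act_neg, act_v, act_v, s_succ, s_castSucc, add_comm]
  rw [map_add, Tcheck_z_succ] at h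
  exact eq_sub_of_add_eq h

/-- The points with all coordinates `0` or `-1`. -/
def IsCube {n : ℕ} (x : Lat n) : Prop := ∀ k, x k = 0 ∨ x k = -1

/-- The span of the `e^x` with all coordinates of `x` equal to `0` or `-1`. -/
def cube (n : ℕ) : Submodule ℂ (GrpAlg n) := Submodule.span ℂ (e '' {x | IsCube x})

/-- The linear map which sends the variable `e^{-v_m}` to `b` and `1` to `a`. -/
def slice (a b : ℂ) {n : ℕ} (m : Fin (n + 1)) : GrpAlg n →ₗ[ℂ] GrpAlg n := extend fun x =>
  if x m = 0 then a • e x else if x m = -1 then b • e (x + v m) else 0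

theorem slice_mul (a b : ℂ) {n : ℕ} {m : Fin (n + 1)} {w : Lat n} (hw : w m = 0)
    (Q : GrpAlg n) : slice a b m (e w * Q) = e w * slice a b m Q := by
  refine eq_of_forall_e (A := slice a b m ∘ₗ LinearMap.mulLeft ℂ (e w))
    (B := LinearMap.mulLeft ℂ (e w) ∘ₗ slice a b m) (fun x => ?_) Q
  simp only [LinearMap.comp_apply, LinearMap.mulLeft_apply, ← e_add, slice, extend_e,
    Pi.add_apply, hw, zero_add]
  split_ifs
  · rw [mul_smul_comm, e_add]
  · rw [mul_smul_comm, ← e_add, add_assoc]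
  · rw [mul_zero]

theorem slice_sg (a b : ℂ) {n : ℕ} (i : Fin n) (m : Fin (n + 1)) (Q : GrpAlg n) :
    slice a b m (sg i Q) = sg i (slice a b (s i m) Q) := by
  refine eq_of_forall_e (A := slice a b m ∘ₗ sg i)
    (B := sg i ∘ₗ slice a b (s i m)) (fun x => ?_) Q
  simp only [LinearMap.comp_apply, slice, extend_e, sg_e, act_s_apply]
  split_ifs
  · rw [map_smul, sg_e]
  · rw [map_smul, sg_e, act_add, act_v, s_s]
  · rw [map_zero]

theorem slice_Tcheck_of_ne (a b : ℂ) {n : ℕ} {i : Fin n} {m : Fin (n + 1)}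
    (h1 : m ≠ i.castSucc) (h2 : m ≠ i.succ) (Q : GrpAlg n) :
    slice a b m (Tcheck α β γ δ i Q) = Tcheck α β γ δ i (slice a b m Q) := by
  have v1 : v i.castSucc m = 0 := by simp [v, h1]
  have v2 : v i.succ m = 0 := by simp [v, h2]
  have h12 : (v i.castSucc + v i.succ) m = 0 := by simp [v1, v2]
  have hnum : ∀ P, slice a b m (num α β γ δ i.castSucc i.succ * P) =
      num α β γ δ i.castSucc i.succ * slice a b m P := by
    intro P
    have hn : ∀ R : GrpAlg n, num α β γ δ i.castSucc i.succ * R =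
        (α * γ) • (e (v i.castSucc + v i.succ) * R) + (α * δ) • (e (v i.castSucc) * R) +
        (β * γ) • (e (v i.succ) * R) + (β * δ) • R := by
      intro R
      simp only [num, e_add, Algebra.smul_def, map_mul]
      ring
    simp only [hn, map_add, map_smul, slice_mul a b h12, slice_mul a b v1, slice_mul a b v2]
  refine (Tcheck_unique α β γ δ ?_).symm
  have h := congrArg (slice a b m) (Tcheck_spec α β γ δ i Q)
  simpa only [sub_mul, map_sub, map_add, slice_mul a b v1, slice_mul a b v2, hnum,
    slice_sg, s_of_ne h1 h2] using h

theorem IsCube.add_v {n : ℕ} {x : Lat n} (hx : IsCube x) {k : Fin (n + 1)} (hk : x k = -1) :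
    IsCube (x + v k) := by
  intro j
  by_cases h : j = k
  · subst h; left; simp [v, hk]
  · simpa [v, h] using hx j

theorem IsCube.sub_v {n : ℕ} {x : Lat n} (hx : IsCube x) {k : Fin (n + 1)} (hk : x k = 0) :
    IsCube (x - v k) := by
  intro j
  by_cases h : j = k
  · subst h; right; simp [v, hk]
  · simpa [v, h] using hx j

theorem e_mem_cube {n : ℕ} {x : Lat n} (hx : IsCube x) : e x ∈ cube n :=
  Submodule.subset_span ⟨x, hx, rfl⟩

/-- To prove that a linear map has values in `M` on `cube n`, it is enough to look at products of
an element without the variables `e^{-v_i}`, `e^{-v_{i+1}}` with a monomial in these. -/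
theorem cube_induction {n : ℕ} (i : Fin n) {M : Submodule ℂ (GrpAlg n)}
    (h : ∀ w, IsCube w → w i.castSucc = 0 → w i.succ = 0 → e w ∈ M ∧ e w * e (-v i.castSucc) ∈ M ∧
      e w * e (-v i.succ) ∈ M ∧ e w * (e (-v i.castSucc) * e (-v i.succ)) ∈ M) : cube n ≤ M := by
  refine Submodule.span_le.mpr ?_
  rintro _ ⟨x, hx, rfl⟩
  have hne := (Fin.castSucc_lt_succ (i := i)).ne
  simp only [← e_add] at h
  rcases hx i.castSucc with h1 | h1 <;> rcases hx i.succ with h2 | h2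
  · exact (h x hx h1 h2).1
  · have := (h (x + v i.succ) (hx.add_v h2) (by simp [v, h1, hne]) (by simp [v, h2])).2.2.1
    rwa [add_neg_cancel_right] at this
  · have := (h (x + v i.castSucc) (hx.add_v h1) (by simp [v, h1])
      (by simp [v, h2, hne.symm])).2.1
    rwa [add_neg_cancel_right] at this
  · have h3 := hx.add_v h1
    have h4 : (x + v i.castSucc) i.succ = -1 := by simp [v, h2, hne.symm]
    have := (h (x + v i.castSucc + v i.succ) (h3.add_v h4)
      (by simp [v, h1, hne]) (by simp [v, h2, hne.symm])).2.2.2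
    rwa [show x + v i.castSucc + v i.succ + (-v i.castSucc + -v i.succ) = x by abel] at this

theorem sg_e_of_eq_zero {n : ℕ} {i : Fin n} {w : Lat n} (h1 : w i.castSucc = 0)
    (h2 : w i.succ = 0) : sg i (e w) = e w := by
  rw [sg_e, act_s_of_root_eq_zero]
  simp [root, h1, h2]

theorem Tcheck_mem_cube {n : ℕ} (i : Fin n) {P : GrpAlg n} (hP : P ∈ cube n) :
    Tcheck α β γ δ i P ∈ cube n := by
  have hne := (Fin.castSucc_lt_succ (i := i)).ne
  suffices H : cube n ≤ (cube n).comap (Tcheck α β γ δ i) from H hP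
  refine cube_induction i fun w hw h1 h2 => ?_
  have hsg := sg_e_of_eq_zero h1 h2
  have m0 : e w ∈ cube n := e_mem_cube hw
  have m1 : e w * e (-v i.castSucc) ∈ cube n := by
    rw [← e_add]; exact e_mem_cube (hw.sub_v h1)
  have m2 : e w * e (-v i.succ) ∈ cube n := by
    rw [← e_add]; exact e_mem_cube (hw.sub_v h2)
  have m3 : e w * (e (-v i.castSucc) * e (-v i.succ)) ∈ cube n := by
    rw [← e_add, ← e_add, ← add_assoc]
    exact e_mem_cube ((hw.sub_v h1).sub_v (k := i.succ) (by simp [v, h2, hne.symm]))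
  have m4 : e w * ((α * γ) • 1 + (1 + β * γ) • e (-v i.castSucc) +
      (α * δ) • e (-v i.succ) + (β * δ) • (e (-v i.castSucc) * e (-v i.succ))) ∈ cube n := by
    simp only [mul_add, mul_smul_comm, mul_one]
    exact add_mem (add_mem (add_mem (Submodule.smul_mem _ _ m0) (Submodule.smul_mem _ _ m1))
      (Submodule.smul_mem _ _ m2)) (Submodule.smul_mem _ _ m3)
  simp only [Submodule.mem_comap]
  refine ⟨?_, ?_, ?_, ?_⟩
  · rwa [Tcheck_of_sg_eq α β γ δ hsg]
  · rw [Tcheck_mul α β γ δ hsg, Tcheck_z_castSucc, mul_sub, mul_add]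
    exact sub_mem (add_mem m1 m2) m4
  · rwa [Tcheck_mul α β γ δ hsg, Tcheck_z_succ]
  · rwa [Tcheck_of_sg_eq]
    rw [sg_mul, sg_mul, hsg, sg_e, sg_e, act_neg, act_neg, act_v, act_v, s_castSucc, s_succ,
      mul_comm (e (-v i.succ))]

theorem slice_one (a b : ℂ) {n : ℕ} (m : Fin (n + 1)) : slice a b m (1 : GrpAlg n) = a • 1 := by
  rw [← e_zero, slice, extend_e]; simp

theorem slice_z (a b : ℂ) {n : ℕ} (m : Fin (n + 1)) :
    slice a b m (e (-v m) : GrpAlg n) = b • 1 := by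
  rw [slice, extend_e]; simp [v, ← e_zero]

theorem slice_z_of_ne (a b : ℂ) {n : ℕ} {m k : Fin (n + 1)} (h : m ≠ k) :
    slice a b m (e (-v k) : GrpAlg n) = a • e (-v k) := by
  rw [slice, extend_e]; simp [v, h]

theorem slice_z_mul (a b : ℂ) {n : ℕ} {m k : Fin (n + 1)} (h : m ≠ k) :
    slice a b m (e (-v k) * e (-v m) : GrpAlg n) = b • e (-v k) := by
  rw [slice_mul _ _ (by simp [v, h]), slice_z, mul_smul_comm, mul_one]

theorem slice_z_mul' (a b : ℂ) {n : ℕ} {m k : Fin (n + 1)} (h : m ≠ k) :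
    slice a b m (e (-v m) * e (-v k) : GrpAlg n) = b • e (-v k) := by
  rw [mul_comm, slice_z_mul a b h]

/-- The slice is, homogenised, the value at z_{i+1} = -γ/δ. There the factor γ e^{v_{i+1}} + δ
vanishes and only the term P.s_i of Ť_i survives. -/
theorem slice_succ_Tcheck {n : ℕ} (i : Fin n) {P : GrpAlg n} (hP : P ∈ cube n) :
    slice δ (-γ) i.succ (Tcheck α β γ δ i P) = sg i (slice δ (-γ) i.castSucc P) := by
  have hne := (Fin.castSucc_lt_succ (i := i)).ne
  suffices H : cube n ≤ LinearMap.eqLocus (slice δ (-γ) i.succ ∘ₗ Tcheck α β γ δ i)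
    (sg i ∘ₗ slice δ (-γ) i.castSucc) from H hP
  refine cube_induction i fun w hw h1 h2 => ?_
  have hsg := sg_e_of_eq_zero h1 h2
  have hsz : sg i (e (-v i.succ)) = e (-v i.castSucc) := by rw [sg_e, act_neg, act_v, s_succ]
  simp only [LinearMap.mem_eqLocus, LinearMap.comp_apply]
  refine ⟨?_, ?_, ?_, ?_⟩
  · rw [← mul_one (e w), Tcheck_mul α β γ δ hsg, Tcheck_of_sg_eq α β γ δ (sg_one i),
      slice_mul _ _ h2, slice_mul _ _ h1, sg_mul, hsg, slice_one, slice_one, map_smul, sg_one]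
  · rw [Tcheck_mul α β γ δ hsg, Tcheck_z_castSucc, slice_mul _ _ h2, slice_mul _ _ h1, sg_mul, hsg]
    simp only [map_sub, map_add, map_smul, slice_one, slice_z, slice_z_of_ne _ _ hne.symm,
      slice_z_mul _ _ hne.symm, sg_one]
    congr 1
    module
  · rw [Tcheck_mul α β γ δ hsg, Tcheck_z_succ, slice_mul _ _ h2, slice_mul _ _ h1, sg_mul, hsg]
    simp only [map_add, map_smul, slice_one, slice_z, slice_z_of_ne _ _ hne.symm,
      slice_z_of_ne _ _ hne, slice_z_mul _ _ hne.symm, hsz]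
    congr 1
    module
  · rw [Tcheck_of_sg_eq, slice_mul _ _ h2, slice_mul _ _ h1, sg_mul, hsg,
      slice_z_mul _ _ hne.symm, slice_z_mul' _ _ hne, map_smul, hsz]
    rw [sg_mul, sg_mul, hsg, sg_e, sg_e, act_neg, act_neg, act_v, act_v, s_castSucc, s_succ,
      mul_comm (e (-v i.succ))]

/-- The mirror image: at z_i = -α/β the factor α e^{v_i} + β vanishes. -/
theorem slice_castSucc_Tcheck {n : ℕ} (i : Fin n) {P : GrpAlg n} (hP : P ∈ cube n) :
    slice β (-α) i.castSucc (Tcheck α β γ δ i P) = sg i (slice β (-α) i.succ P) := by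
  have hne := (Fin.castSucc_lt_succ (i := i)).ne
  suffices H : cube n ≤ LinearMap.eqLocus (slice β (-α) i.castSucc ∘ₗ Tcheck α β γ δ i)
    (sg i ∘ₗ slice β (-α) i.succ) from H hP
  refine cube_induction i fun w hw h1 h2 => ?_
  have hsg := sg_e_of_eq_zero h1 h2
  have hsz : sg i (e (-v i.castSucc)) = e (-v i.succ) := by rw [sg_e, act_neg, act_v, s_castSucc]
  simp only [LinearMap.mem_eqLocus, LinearMap.comp_apply]
  refine ⟨?_, ?_, ?_, ?_⟩
  · rw [← mul_one (e w), Tcheck_mul α β γ δ hsg, Tcheck_of_sg_eq α β γ δ (sg_one i),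
      slice_mul _ _ h2, slice_mul _ _ h1, sg_mul, hsg, slice_one, slice_one, map_smul, sg_one]
  · rw [Tcheck_mul α β γ δ hsg, Tcheck_z_castSucc, slice_mul _ _ h2, slice_mul _ _ h1, sg_mul, hsg]
    simp only [map_sub, map_add, map_smul, slice_one, slice_z, slice_z_of_ne _ _ hne.symm,
      slice_z_of_ne _ _ hne, slice_z_mul' _ _ hne, hsz]
    congr 1
    module
  · rw [Tcheck_mul α β γ δ hsg, Tcheck_z_succ, slice_mul _ _ h2, slice_mul _ _ h1, sg_mul, hsg]
    simp only [map_add, map_smul, slice_one, slice_z,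
      slice_z_of_ne _ _ hne, slice_z_mul' _ _ hne, sg_one]
    congr 1
    module
  · rw [Tcheck_of_sg_eq, slice_mul _ _ h2, slice_mul _ _ h1, sg_mul, hsg,
      slice_z_mul _ _ hne.symm, slice_z_mul' _ _ hne, map_smul, hsz]
    rw [sg_mul, sg_mul, hsg, sg_e, sg_e, act_neg, act_neg, act_v, act_v, s_castSucc, s_succ,
      mul_comm (e (-v i.succ))]

theorem eq_slice_add {n : ℕ} (m : Fin (n + 1)) {P : GrpAlg n} (hP : P ∈ cube n) :
    P = slice 1 0 m P + e (-v m) * slice 0 1 m P := by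
  suffices H : cube n ≤ LinearMap.eqLocus LinearMap.id
    (slice 1 0 m + LinearMap.mulLeft ℂ (e (-v m)) ∘ₗ slice 0 1 m) from H hP
  refine Submodule.span_le.mpr ?_
  rintro _ ⟨x, hx, rfl⟩
  simp only [SetLike.mem_coe, LinearMap.mem_eqLocus, LinearMap.id_apply, LinearMap.add_apply,
    LinearMap.comp_apply, LinearMap.mulLeft_apply, slice, extend_e]
  rcases hx m with h | h
  · simp [h]
  · simp [h, ← e_add]

theorem smul_slice_add (a b a' b' c c' : ℂ) {n : ℕ} (m : Fin (n + 1)) (P : GrpAlg n) :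
    c • slice a b m P + c' • slice a' b' m P = slice (c * a + c' * a') (c * b + c' * b') m P := by
  refine eq_of_forall_e (A := c • slice a b m + c' • slice a' b' m)
    (B := slice (c * a + c' * a') (c * b + c' * b') m) (fun x => ?_) P
  simp only [LinearMap.add_apply, LinearMap.smul_apply, slice, extend_e]
  split_ifs
  · rw [smul_smul, smul_smul, ← add_smul]
  · rw [smul_smul, smul_smul, ← add_smul]
  · simp

/-- The linear forms (δ, -γ) and (β, -α) are independent, with determinant βγ - αδ. Inverting them
recovers both coefficients of P as a polynomial in z_m. -/
theorem eq_zero_of_slice {n : ℕ} {m : Fin (n + 1)} {P : GrpAlg n} (hP : P ∈ cube n)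
    (hne : α * δ - β * γ ≠ 0) (h1 : slice δ (-γ) m P = 0) (h2 : slice β (-α) m P = 0) :
    P = 0 := by
  have k1 := smul_slice_add δ (-γ) β (-α) (α / (α * δ - β * γ)) (-γ / (α * δ - β * γ)) m P
  have k2 := smul_slice_add δ (-γ) β (-α) (β / (α * δ - β * γ)) (-δ / (α * δ - β * γ)) m P
  have e1 : α / (α * δ - β * γ) * δ + -γ / (α * δ - β * γ) * β = 1 := by field_simp; ring
  have e2 : α / (α * δ - β * γ) * -γ + -γ / (α * δ - β * γ) * -α = 0 := by field_simp; ring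
  have e3 : β / (α * δ - β * γ) * δ + -δ / (α * δ - β * γ) * β = 0 := by field_simp; ring
  have e4 : β / (α * δ - β * γ) * -γ + -δ / (α * δ - β * γ) * -α = 1 := by field_simp; ring
  rw [h1, h2, smul_zero, smul_zero, add_zero, e1, e2] at k1
  rw [h1, h2, smul_zero, smul_zero, add_zero, e3, e4] at k2
  rw [eq_slice_add m hP, ← k1, ← k2, mul_zero, add_zero]

end Params

/-! ### Sets of indices in an interval and the multilinear family attached to them. -/

/-- The indicator vector `∑_{j ∈ J} v_j`. -/
def ind {n : ℕ} (J : Finset (Fin (n + 1))) : Lat n := fun k => if k ∈ J then 1 else 0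

/-- The image of a set of indices under `s_i`. -/
def sw {n : ℕ} (i : Fin n) (J : Finset (Fin (n + 1))) : Finset (Fin (n + 1)) :=
  J.map (s i).toEmbedding

theorem mem_sw {n : ℕ} {i : Fin n} {J : Finset (Fin (n + 1))} {k : Fin (n + 1)} :
    k ∈ sw i J ↔ s i k ∈ J := by
  rw [sw, Finset.mem_map_equiv]
  rfl

theorem act_s_ind {n : ℕ} (i : Fin n) (J : Finset (Fin (n + 1))) :
    act (s i) (ind J) = ind (sw i J) := by
  funext k
  simp only [act_s_apply, ind, mem_sw]

theorem sw_sw {n : ℕ} (i : Fin n) (J : Finset (Fin (n + 1))) : sw i (sw i J) = J := by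
  ext k
  rw [mem_sw, mem_sw, s_s]

theorem sw_insert {n : ℕ} (i : Fin n) (k : Fin (n + 1)) (J : Finset (Fin (n + 1))) :
    sw i (insert k J) = insert (s i k) (sw i J) := by
  simp [sw]

theorem sw_eq_self {n : ℕ} {i : Fin n} {J : Finset (Fin (n + 1))}
    (h : i.castSucc ∈ J ↔ i.succ ∈ J) : sw i J = J := by
  ext k
  rw [mem_sw]
  by_cases h1 : k = i.castSucc
  · rw [h1, s_castSucc, h]
  · by_cases h2 : k = i.succ
    · rw [h2, s_succ, h]
    · rw [s_of_ne h1 h2]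

theorem ind_insert {n : ℕ} {k : Fin (n + 1)} {J : Finset (Fin (n + 1))} (h : k ∉ J) :
    ind (insert k J) = ind J + v k := by
  funext j
  by_cases hj : j = k
  · subst hj; simp [ind, v, h]
  · simp [ind, v, hj]

/-- The indices `k` with `p ≤ k < e`. -/
def blk (n p e : ℕ) : Finset (Fin (n + 1)) :=
  Finset.univ.filter fun k => p ≤ k.val ∧ k.val < e

theorem mem_blk {n p e : ℕ} {k : Fin (n + 1)} : k ∈ blk n p e ↔ p ≤ k.val ∧ k.val < e := by
  simp [blk]

theorem sum_sw {n : ℕ} {i : Fin n} {J : Finset (Fin (n + 1))} (h1 : i.castSucc ∉ J)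
    (h2 : i.succ ∈ J) : ∑ j ∈ J, j.val = ∑ j ∈ sw i J, j.val + 1 := by
  rw [sw, Finset.sum_map, ← Finset.add_sum_erase _ _ h2, ← Finset.add_sum_erase _ _ h2]
  have : ∑ x ∈ J.erase i.succ, ((s i).toEmbedding x).val = ∑ x ∈ J.erase i.succ, x.val := by
    refine Finset.sum_congr rfl fun x hx => ?_
    rw [Finset.mem_erase] at hx
    have hx1 : x ≠ i.castSucc := fun h => h1 (h ▸ hx.2)
    simp [s_of_ne hx1 hx.1]
  rw [this]
  simp only [Equiv.coe_toEmbedding, s_succ, Fin.val_succ, Fin.val_castSucc]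
  omega

/-- Induction on sets of indices in `[p, e)`: begin with the final segments and move elements to
the left. -/
theorem family_induction {n p e : ℕ} {motive : Finset (Fin (n + 1)) → Prop}
    (final : ∀ m, p ≤ m → m ≤ e → motive (blk n m e))
    (step : ∀ J, J ⊆ blk n p e → ∀ i : Fin n, p ≤ i.val → i.val + 1 < e → i.castSucc ∉ J →
      i.succ ∈ J → motive J → motive (sw i J))
    (hpe : p ≤ e) (J : Finset (Fin (n + 1))) (hJ : J ⊆ blk n p e) : motive J := by
  -- Undoing a move to the left raises the sum of the elements by one, and this sum is bounded by (n
  -- + 1)².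
  induction hN : (n + 1) * (n + 1) - ∑ j ∈ J, j.val using Nat.strong_induction_on
    generalizing J with
  | _ N ih =>
    -- If no element can move right, J is empty or runs from its minimum to the end of the interval.
    by_cases h : ∃ i : Fin n, i.castSucc ∈ J ∧ i.succ ∉ J ∧ i.val + 1 < e
    · obtain ⟨i, h1, h2, h3⟩ := h
      have hp : p ≤ i.val := by simpa using (mem_blk.mp (hJ h1)).1
      have m1 : i.castSucc ∉ sw i J := by rwa [mem_sw, s_castSucc]
      have m2 : i.succ ∈ sw i J := by rwa [mem_sw, s_succ]
      have hsub : sw i J ⊆ blk n p e := by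
        intro k hk
        rw [mem_sw] at hk
        have h4 := mem_blk.mp (hJ hk)
        rw [s_val] at h4
        rw [mem_blk]
        split_ifs at h4 <;> omega
      have hsum := sum_sw m1 m2
      rw [sw_sw] at hsum
      have hle : ∑ j ∈ sw i J, j.val ≤ (n + 1) * (n + 1) := by
        refine (Finset.sum_le_card_nsmul _ _ (n + 1) fun j _ => j.isLt.le).trans ?_
        rw [smul_eq_mul]
        exact Nat.mul_le_mul_right _ (by simpa using Finset.card_le_univ (sw i J))
      have := step (sw i J) hsub i hp h3 m1 m2 (ih _ (by omega) _ hsub rfl)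
      rwa [sw_sw] at this
    · push Not at h
      rcases J.eq_empty_or_nonempty with rfl | hne
      · have := final e hpe le_rfl
        rwa [show blk n e e = ∅ from Finset.filter_eq_empty_iff.mpr fun k _ => by omega] at this
      · have hm := mem_blk.mp (hJ (J.min'_mem hne))
        have hall : ∀ k : ℕ, (J.min' hne).val ≤ k → k < e → ∀ hk : k < n + 1,
            (⟨k, hk⟩ : Fin (n + 1)) ∈ J := by
          intro k hk
          induction k, hk using Nat.le_induction with
          | base => intro _ _; exact J.min'_mem hne
          | succ k hk ih' =>
            intro hke hkn
            by_contra hc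
            have := h ⟨k, by omega⟩ (ih' (by omega) (by omega)) hc
            simp only at this
            omega
        have hJe : J = blk n (J.min' hne).val e := by
          ext k
          rw [mem_blk]
          constructor
          · intro hk
            exact ⟨J.min'_le k hk, (mem_blk.mp (hJ hk)).2⟩
          · intro hk
            exact hall k.val hk.1 hk.2 k.isLt
        rw [hJe]
        exact final _ hm.1 hm.2.le

section Params

variable (α β γ δ : ℂ)

/-- The lattice point with coordinates `0` before `e` and `-1` from `e` on. -/
def stair (n e : ℕ) : Lat n := fun k => if k.val < e then 0 else -1

/-- For a set `J` of indices less than `e`, the image of the monomial of the final segment of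
`[0, e)` with as many elements as `J` under the operators `Ť_i` which move this segment to `J`. -/
def blockFam {n : ℕ} (e' : ℕ) (J : Finset (Fin (n + 1))) : GrpAlg n :=
  e (-stair n e') * propag α β γ δ (stair n e' - ind J)

theorem stair_eq {n e : ℕ} {i : Fin n} (h : i.val + 1 < e) :
    stair n e i.castSucc = 0 ∧ stair n e i.succ = 0 := by
  simp only [stair, Fin.val_castSucc, Fin.val_succ]
  rw [if_pos (by omega), if_pos h]
  exact ⟨rfl, rfl⟩

theorem Tcheck_blockFam {n e : ℕ} {i : Fin n} (h : i.val + 1 < e) {J : Finset (Fin (n + 1))}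
    (hJ : i.castSucc ∈ J → i.succ ∈ J) :
    Tcheck α β γ δ i (blockFam α β γ δ e J) = blockFam α β γ δ e (sw i J) := by
  obtain ⟨h1, h2⟩ := stair_eq h
  have hr : root i (stair n e) = 0 := by rw [root, h1, h2, sub_zero]
  rw [blockFam, Tcheck_mul, Tcheck_propag, act_sub, act_s_of_root_eq_zero hr, act_s_ind, blockFam]
  · simp only [root, Pi.sub_apply, h1, h2, ind]
    split_ifs <;> simp_all
  · rw [sg_e, act_neg, act_s_of_root_eq_zero hr]

theorem blockFam_final {n m e' : ℕ} :
    blockFam α β γ δ e' (blk n m e') = e (-ind (blk n m e')) := by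
  rw [blockFam, propag_of_dominant, ← e_add]
  · congr 1; abel
  · rw [dominant_iff_antitone]
    intro k l hkl
    have hkl' : k.val ≤ l.val := hkl
    simp only [Pi.sub_apply, stair, ind, mem_blk]
    split_ifs <;> omega

theorem blockFam_empty {n e' : ℕ} : blockFam α β γ δ e' (∅ : Finset (Fin (n + 1))) = 1 := by
  have h := blockFam_final α β γ δ (n := n) (m := e') (e' := e')
  rw [show blk n e' e' = ∅ from Finset.filter_eq_empty_iff.mpr fun k _ => by omega] at h
  rw [h, ← e_zero]
  rfl

theorem isCube_neg_ind {n : ℕ} (J : Finset (Fin (n + 1))) : IsCube (-ind J) := by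
  intro k
  simp only [Pi.neg_apply, ind]
  split_ifs <;> simp

theorem blockFam_mem_cube {n e : ℕ} {J : Finset (Fin (n + 1))} (hJ : J ⊆ blk n 0 e) :
    blockFam α β γ δ e J ∈ cube n := by
  refine family_induction (motive := fun J => blockFam α β γ δ e J ∈ cube n) ?_ ?_
    (Nat.zero_le e) J hJ
  · intro m _ _
    rw [blockFam_final]
    exact e_mem_cube (isCube_neg_ind _)
  · intro J _ i _ hi h1 h2 ih
    rw [← Tcheck_blockFam α β γ δ hi (fun h => absurd h h1)]
    exact Tcheck_mem_cube α β γ δ i ih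

theorem dominant_sub_ind {n m e' : ℕ} {y : Lat n} (hy : Dominant y) {c : ℤ}
    (hc : ∀ k ∈ blk n m e', y k = c) (hlt : ∀ k : Fin (n + 1), e' ≤ k.val → y k < c) :
    Dominant (y - ind (blk n m e')) := by
  rw [dominant_iff_antitone] at hy ⊢
  intro k l hkl
  have hkl' : k.val ≤ l.val := hkl
  have h1 := hy hkl
  have h2 := hc k
  have h3 := hc l
  have h4 := hlt l
  simp only [mem_blk] at h2 h3
  simp only [Pi.sub_apply, ind, mem_blk]
  split_ifs <;> omega

/-- The elements of `blockFam` describe the propagation at any dominant point, on an interval of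
indices where the point is constant. -/
theorem e_mul_blockFam {n p e' : ℕ} {y : Lat n} (hy : Dominant y) {c : ℤ}
    (hc : ∀ k ∈ blk n p e', y k = c) (hlt : ∀ k : Fin (n + 1), e' ≤ k.val → y k < c)
    (hpe : p ≤ e') {J : Finset (Fin (n + 1))} (hJ : J ⊆ blk n p e') :
    e y * blockFam α β γ δ e' J = propag α β γ δ (y - ind J) := by
  refine family_induction
    (motive := fun J => e y * blockFam α β γ δ e' J = propag α β γ δ (y - ind J)) ?_ ?_ hpe J hJ
  · intro m hm _
    rw [blockFam_final, ← e_add, ← sub_eq_add_neg, propag_of_dominant]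
    refine dominant_sub_ind hy (fun k hk => hc k ?_) hlt
    rw [mem_blk] at hk ⊢
    omega
  · intro J _ i hp hi h1 h2 ih
    have hr : root i y = 0 := by
      rw [root, hc i.castSucc, hc i.succ, sub_self]
      · rw [mem_blk, Fin.val_succ]; omega
      · rw [mem_blk, Fin.val_castSucc]; omega
    have hr' : 0 ≤ root i (y - ind J) := by
      simp only [root] at hr
      simp only [root, Pi.sub_apply, ind, h1, h2, if_true, if_false]
      omega
    rw [← Tcheck_blockFam α β γ δ hi (fun h => absurd h h1), ← Tcheck_mul, ih,
      Tcheck_propag α β γ δ hr', act_sub, act_s_of_root_eq_zero hr, act_s_ind]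
    rw [sg_e, act_s_of_root_eq_zero hr]

/-! ### Slices of the elements of `blockFam` -/

theorem slice_e_neg_ind_of_notMem (a b : ℂ) {n : ℕ} {m : Fin (n + 1)} {J : Finset (Fin (n + 1))}
    (h : m ∉ J) : slice a b m (e (-ind J)) = a • e (-ind J) := by
  rw [slice, extend_e, if_pos (by simp [ind, h])]

theorem slice_e_neg_ind_insert (a b : ℂ) {n : ℕ} {m : Fin (n + 1)} {J : Finset (Fin (n + 1))}
    (h : m ∉ J) : slice a b m (e (-ind (insert m J))) = b • e (-ind J) := by
  rw [slice, extend_e, if_neg (by simp [ind]), if_pos (by simp [ind]), ind_insert h]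
  congr 2
  abel

theorem blk_succ_right {n p : ℕ} {m : Fin (n + 1)} (h : p ≤ m.val) :
    blk n p (m.val + 1) = insert m (blk n p m.val) := by
  ext k
  rw [Finset.mem_insert, mem_blk, mem_blk, Fin.ext_iff]
  omega

theorem blk_succ_left {n e : ℕ} {p : Fin (n + 1)} (h : p.val < e) :
    blk n p.val e = insert p (blk n (p.val + 1) e) := by
  ext k
  rw [Finset.mem_insert, mem_blk, mem_blk, Fin.ext_iff]
  omega

theorem notMem_blk_right {n p : ℕ} {m : Fin (n + 1)} : m ∉ blk n p m.val := by
  rw [mem_blk]; omega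

theorem notMem_blk_left {n e : ℕ} {p : Fin (n + 1)} : p ∉ blk n (p.val + 1) e := by
  rw [mem_blk]; omega

/-- A segment with a hole at k. With the hole at the left end the element is a monomial; each Ť_i
moves the hole one place right, and the slice taken at the hole follows by `slice_succ_Tcheck`. -/
theorem slice_blockFam_erase {n l e' : ℕ} (k : ℕ) (hlk : l ≤ k) (hke : k ≤ e')
    (hk : k < n + 1) :
    slice δ (-γ) ⟨k, hk⟩ (blockFam α β γ δ (e' + 1) ((blk n l (e' + 1)).erase ⟨k, hk⟩)) =
      δ • e (-ind ((blk n l (e' + 1)).erase ⟨k, hk⟩)) := by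
  induction k, hlk using Nat.le_induction with
  | base =>
    have h : (blk n l (e' + 1)).erase ⟨l, hk⟩ = blk n (l + 1) (e' + 1) := by
      ext j
      simp only [Finset.mem_erase, mem_blk, Ne, Fin.ext_iff]
      omega
    rw [h, blockFam_final, slice_e_neg_ind_of_notMem]
    simp [mem_blk]
  | succ k hlk ih =>
    have ih := ih (by omega) (by omega)
    have hks : k < n := by omega
    have e1 : (⟨k + 1, hk⟩ : Fin (n + 1)) = (⟨k, hks⟩ : Fin n).succ := rfl
    have e2 : (⟨k, by omega⟩ : Fin (n + 1)) = (⟨k, hks⟩ : Fin n).castSucc := rfl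
    rw [e2] at ih
    rw [e1]
    generalize hi : (⟨k, hks⟩ : Fin n) = i at *
    have hiv : i.val = k := by rw [← hi]
    have hsw : (blk n l (e' + 1)).erase i.succ =
        sw i ((blk n l (e' + 1)).erase i.castSucc) := by
      ext j
      simp only [Finset.mem_erase, mem_blk, mem_sw, Ne, Fin.ext_iff, s_val, Fin.val_succ,
        Fin.val_castSucc]
      split_ifs <;> omega
    have hmem : blockFam α β γ δ (e' + 1) ((blk n l (e' + 1)).erase i.castSucc) ∈ cube n := by
      refine blockFam_mem_cube α β γ δ fun j hj => ?_
      rw [Finset.mem_erase, mem_blk] at hj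
      rw [mem_blk]
      omega
    rw [hsw, ← Tcheck_blockFam α β γ δ (by omega) (by simp), slice_succ_Tcheck α β γ δ i hmem,
      ih, map_smul, sg_e, act_neg, act_s_ind]

/-- A final segment of [0, m) is a segment of [0, m + 1) with its hole at m. The remaining J come
from operators Ť_i that do not touch m and so commute with the slice. -/
theorem slice_blockFam_last {n : ℕ} (m : Fin (n + 1)) {J : Finset (Fin (n + 1))}
    (hJ : J ⊆ blk n 0 m.val) :
    slice δ (-γ) m (blockFam α β γ δ (m.val + 1) J) = δ • blockFam α β γ δ m.val J := by
  refine family_induction (motive := fun J => slice δ (-γ) m (blockFam α β γ δ (m.val + 1) J) =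
    δ • blockFam α β γ δ m.val J) ?_ ?_ (Nat.zero_le _) J hJ
  · intro l _ hl
    have h := slice_blockFam_erase α β γ δ (n := n) (l := l) (e' := m.val) m.val hl
      le_rfl m.isLt
    rw [show (⟨m.val, m.isLt⟩ : Fin (n + 1)) = m from rfl, blk_succ_right hl,
      Finset.erase_insert notMem_blk_right] at h
    rw [h, blockFam_final]
  · intro J _ i _ hi h1 h2 ih
    rw [← Tcheck_blockFam α β γ δ hi (fun h => absurd h h1),
      ← Tcheck_blockFam α β γ δ (by omega) (fun h => absurd h h1), slice_Tcheck_of_ne, ih, map_smul]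
    · rw [Ne, Fin.ext_iff, Fin.val_castSucc]; omega
    · rw [Ne, Fin.ext_iff, Fin.val_succ]; omega

theorem slice_blockFam_insert_last {n : ℕ} (m : Fin (n + 1)) {J : Finset (Fin (n + 1))}
    (hJ : J ⊆ blk n 0 m.val) :
    slice δ (-γ) m (blockFam α β γ δ (m.val + 1) (insert m J)) =
      (-γ) • blockFam α β γ δ m.val J := by
  refine family_induction (motive := fun J =>
    slice δ (-γ) m (blockFam α β γ δ (m.val + 1) (insert m J)) =
    (-γ) • blockFam α β γ δ m.val J) ?_ ?_ (Nat.zero_le _) J hJ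
  · intro l _ hl
    rw [← blk_succ_right hl, blockFam_final, blockFam_final, blk_succ_right hl,
      slice_e_neg_ind_insert _ _ notMem_blk_right]
  · intro J _ i _ hi h1 h2 ih
    have hm1 : m ≠ i.castSucc := by rw [Ne, Fin.ext_iff, Fin.val_castSucc]; omega
    have hm2 : m ≠ i.succ := by rw [Ne, Fin.ext_iff, Fin.val_succ]; omega
    have hsw : insert m (sw i J) = sw i (insert m J) := by rw [sw_insert, s_of_ne hm1 hm2]
    rw [hsw, ← Tcheck_blockFam α β γ δ hi (fun h => absurd h h1),
      ← Tcheck_blockFam α β γ δ (by omega) (by simp [hm1.symm, h1]),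
      slice_Tcheck_of_ne α β γ δ _ _ hm1 hm2, ih, map_smul]

theorem slice_blockFam_first {n e' : ℕ} (p : Fin (n + 1)) (hp : p.val + 1 ≤ e')
    {J : Finset (Fin (n + 1))} (hJ : J ⊆ blk n (p.val + 1) e') :
    slice β (-α) p (blockFam α β γ δ e' J) = β • blockFam α β γ δ e' J := by
  refine family_induction (motive := fun J => slice β (-α) p (blockFam α β γ δ e' J) =
    β • blockFam α β γ δ e' J) ?_ ?_ hp J hJ
  · intro l hl _
    rw [blockFam_final, slice_e_neg_ind_of_notMem]
    rw [mem_blk]; omega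
  · intro J _ i hpi hi h1 h2 ih
    rw [← Tcheck_blockFam α β γ δ hi (fun h => absurd h h1), slice_Tcheck_of_ne, ih, map_smul]
    · rw [Ne, Fin.ext_iff, Fin.val_castSucc]; omega
    · rw [Ne, Fin.ext_iff, Fin.val_succ]; omega

/-- Dual to `slice_blockFam_erase`: one isolated element k starts adjacent to a final segment (d =
0) and moves left away from it, and the slice taken at k moves along by `slice_castSucc_Tcheck`. -/
theorem slice_blockFam_insert {n l e' : ℕ} (hle : l ≤ e') (he : e' ≤ n + 1) (k d : ℕ)
    (hkd : k + d + 1 = l) (hk : k < n + 1) :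
    slice β (-α) ⟨k, hk⟩ (blockFam α β γ δ e' (insert ⟨k, hk⟩ (blk n l e'))) =
      (-α) • e (-ind (blk n l e')) := by
  induction d generalizing k with
  | zero =>
    have hl : l = (⟨k, hk⟩ : Fin (n + 1)).val + 1 := by simp only; omega
    rw [hl, ← blk_succ_left (by omega), blockFam_final, blk_succ_left (by omega),
      slice_e_neg_ind_insert _ _ notMem_blk_left]
  | succ d ih =>
    have hks : k < n := by omega
    have ih := ih (k + 1) (by omega) (by omega)
    have e1 : (⟨k + 1, by omega⟩ : Fin (n + 1)) = (⟨k, hks⟩ : Fin n).succ := rfl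
    have e2 : (⟨k, hk⟩ : Fin (n + 1)) = (⟨k, hks⟩ : Fin n).castSucc := rfl
    rw [e1] at ih
    rw [e2]
    generalize hi : (⟨k, hks⟩ : Fin n) = i at *
    have hiv : i.val = k := by rw [← hi]
    have n1 : i.castSucc ∉ blk n l e' := by rw [mem_blk, Fin.val_castSucc]; omega
    have n2 : i.succ ∉ blk n l e' := by rw [mem_blk, Fin.val_succ]; omega
    have hs0 : sw i (blk n l e') = blk n l e' := sw_eq_self (by simp [n1, n2])
    have hsw : insert i.castSucc (blk n l e') = sw i (insert i.succ (blk n l e')) := by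
      rw [sw_insert, hs0, s_succ]
    have hmem : blockFam α β γ δ e' (insert i.succ (blk n l e')) ∈ cube n := by
      refine blockFam_mem_cube α β γ δ fun j hj => ?_
      rw [Finset.mem_insert, mem_blk, Fin.ext_iff, Fin.val_succ] at hj
      rw [mem_blk]
      omega
    rw [hsw, ← Tcheck_blockFam α β γ δ (by omega) (by simp), slice_castSucc_Tcheck α β γ δ i hmem,
      ih, map_smul, sg_e, act_neg, act_s_ind, hs0]

theorem slice_blockFam_insert_first {n e' : ℕ} (p : Fin (n + 1)) (hp : p.val + 1 ≤ e')
    (he : e' ≤ n + 1) {J : Finset (Fin (n + 1))} (hJ : J ⊆ blk n (p.val + 1) e') :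
    slice β (-α) p (blockFam α β γ δ e' (insert p J)) = (-α) • blockFam α β γ δ e' J := by
  refine family_induction (motive := fun J => slice β (-α) p (blockFam α β γ δ e' (insert p J)) =
    (-α) • blockFam α β γ δ e' J) ?_ ?_ hp J hJ
  · intro l hl hle
    rw [blockFam_final]
    exact slice_blockFam_insert α β γ δ hle he p.val (l - p.val - 1) (by omega) p.isLt
  · intro J _ i hpi hi h1 h2 ih
    have hm1 : p ≠ i.castSucc := by rw [Ne, Fin.ext_iff, Fin.val_castSucc]; omega
    have hm2 : p ≠ i.succ := by rw [Ne, Fin.ext_iff, Fin.val_succ]; omega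
    have hsw : insert p (sw i J) = sw i (insert p J) := by rw [sw_insert, s_of_ne hm1 hm2]
    rw [hsw, ← Tcheck_blockFam α β γ δ hi (fun h => absurd h h1),
      ← Tcheck_blockFam α β γ δ hi (by simp [hm1.symm, h1]),
      slice_Tcheck_of_ne α β γ δ _ _ hm1 hm2, ih, map_smul]

end Params

/-! ### Recursions for the coefficients of the Hamiltonian. -/

theorem qint_succ (q : ℂ) (m : ℕ) : qint q (m + 1) = qint q m + q ^ m := by
  rw [qint, Finset.sum_range_succ, ← qint]

theorem sub_one_mul_qint (q : ℂ) (m : ℕ) : (q - 1) * qint q m = q ^ m - 1 := by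
  induction m with
  | zero => simp [qint]
  | succ m ih => rw [qint_succ, mul_add, ih, pow_succ]; ring

theorem qint_add (q : ℂ) (a b : ℕ) : qint q (a + b) = qint q a + q ^ a * qint q b := by
  rw [qint, Finset.sum_range_add, ← qint]
  simp only [pow_add, ← Finset.mul_sum]
  rfl

theorem qfact_succ (q : ℂ) (m : ℕ) : qfact q (m + 1) = qfact q m * qint q (m + 1) := by
  rw [qfact, Finset.prod_range_succ, ← qfact]

section Params

variable (α β γ δ : ℂ)

/-- The denominators `1 + βγ [m]`. -/
def den (m : ℕ) : ℂ := 1 + β * γ * qint (qpar α β γ δ) m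

/-- The coefficients of the discrete Hamiltonian for a set of `r` indices in a block with `d`
elements, without the power of `q` which depends on the position of the indices. -/
def coef (d : ℕ) : ℕ → ℂ
  | 0 => -(α * γ) * ∑ j ∈ Finset.range d, qint (qpar α β γ δ) j / den α β γ δ j
  | r + 1 => (-(β * δ)) ^ r * qfact (qpar α β γ δ) r * (qpar α β γ δ ^ ((r + 1) * r / 2))⁻¹ /
      ∏ p ∈ Finset.range (r + 1), den α β γ δ (d - 1 - p)

/-- Both sides are the product of `den (d - p)` over p ≤ r + 1, with either its last or its first
factor split off. -/
theorem prod_den (d r : ℕ) :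
    (∏ p ∈ Finset.range (r + 1), den α β γ δ (d + 1 - 1 - p)) * den α β γ δ (d - (r + 1)) =
      den α β γ δ d * ∏ p ∈ Finset.range (r + 1), den α β γ δ (d - 1 - p) := by
  have h1 := Finset.prod_range_succ (fun p => den α β γ δ (d - p)) (r + 1)
  have h2 := Finset.prod_range_succ' (fun p => den α β γ δ (d - p)) (r + 1)
  simp only [Nat.add_sub_cancel, Nat.sub_zero] at h1 h2 ⊢
  rw [← h1, h2, mul_comm]
  congr 1
  refine Finset.prod_congr rfl fun p _ => ?_
  congr 1
  omega

variable {α β γ δ}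

theorem coef_succ_succ (d r : ℕ) : coef α β γ δ (d + 1) (r + 2) =
    (-(β * δ)) ^ (r + 1) * (qfact (qpar α β γ δ) r * qint (qpar α β γ δ) (r + 1)) *
      ((qpar α β γ δ ^ ((r + 1) * r / 2))⁻¹ * (qpar α β γ δ ^ (r + 1))⁻¹) /
      (den α β γ δ d * ∏ p ∈ Finset.range (r + 1), den α β γ δ (d - 1 - p)) := by
  have h : (r + 1 + 1) * (r + 1) / 2 = (r + 1) * r / 2 + (r + 1) := by
    rw [show (r + 1 + 1) * (r + 1) = (r + 1) * r + (r + 1) * 2 by ring,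
      Nat.add_mul_div_right _ _ two_pos]
  rw [coef, h, pow_add (qpar α β γ δ), mul_inv, ← qfact_succ, Finset.prod_range_succ, ← prod_den]
  simp

theorem coef_succ (d r : ℕ) (h : den α β γ δ (d - (r + 1)) ≠ 0) :
    coef α β γ δ (d + 1) (r + 1) =
      coef α β γ δ d (r + 1) * den α β γ δ (d - (r + 1)) / den α β γ δ d := by
  have hp := prod_den α β γ δ d r
  rw [coef, coef, div_mul_eq_mul_div, div_div,
    mul_comm (∏ p ∈ Finset.range (r + 1), den α β γ δ (d - 1 - p)), ← hp, mul_div_mul_right _ _ h]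

/-- The recursion produced by slicing the expansion at the last variable. The exceptional term at r
= 0 is the constant -γ that the last variable contributes to the slice of the sum of the z_k. -/
theorem coef_last (hq : qpar α β γ δ ≠ 0) {d : ℕ} (hd : ∀ m ≤ d, den α β γ δ m ≠ 0) {r : ℕ}
    (hr : r ≤ d) :
    δ * coef α β γ δ (d + 1) r - γ * qpar α β γ δ ^ d * coef α β γ δ (d + 1) (r + 1) =
      δ * coef α β γ δ d r - if r = 0 then γ else 0 := by
  have h0 := hd d le_rfl
  obtain _ | r := r
  · have h1 := sub_one_mul_qint (qpar α β γ δ) d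
    have hc1 : coef α β γ δ (d + 1) (0 + 1) = 1 / den α β γ δ d := by
      simp [coef, qfact]
    have hc0 : coef α β γ δ (d + 1) 0 = coef α β γ δ d 0 +
        -(α * γ) * (qint (qpar α β γ δ) d / den α β γ δ d) := by
      rw [coef, Finset.sum_range_succ, mul_add, ← coef]
    rw [hc1, hc0, if_pos rfl]
    have hq' : qpar α β γ δ ^ d = (qpar α β γ δ - 1) * qint (qpar α β γ δ) d + 1 := by
      rw [h1]; ring
    rw [hq']
    field_simp
    simp only [den, qpar]
    ring
  · have hr' := hd (d - (r + 1)) (by omega)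
    have hP : ∏ p ∈ Finset.range (r + 1), den α β γ δ (d - 1 - p) ≠ 0 :=
      Finset.prod_ne_zero_iff.mpr fun p _ => hd _ (by omega)
    have hadd : den α β γ δ d = den α β γ δ (d - (r + 1)) + β * γ * (qpar α β γ δ ^ (d - (r + 1)) *
        qint (qpar α β γ δ) (r + 1)) := by
      have := qint_add (qpar α β γ δ) (d - (r + 1)) (r + 1)
      rw [Nat.sub_add_cancel hr] at this
      simp only [den, this]
      ring
    have hpow : qpar α β γ δ ^ d = qpar α β γ δ ^ (d - (r + 1)) * qpar α β γ δ ^ (r + 1) := by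
      rw [← pow_add, Nat.sub_add_cancel hr]
    rw [coef_succ_succ, coef_succ _ _ hr', if_neg (by omega), coef, hpow]
    generalize ∏ p ∈ Finset.range (r + 1), den α β γ δ (d - 1 - p) = P at *
    have hqr := pow_ne_zero (r + 1) hq
    have hqr' := pow_ne_zero ((r + 1) * r / 2) hq
    generalize qpar α β γ δ ^ ((r + 1) * r / 2) = Q1 at *
    generalize qpar α β γ δ ^ (r + 1) = Q2 at *
    generalize qpar α β γ δ ^ (d - (r + 1)) = Q3 at *
    generalize qint (qpar α β γ δ) (r + 1) = I at *
    generalize den α β γ δ (d - (r + 1)) = D at *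
    generalize den α β γ δ d = E at *
    generalize qfact (qpar α β γ δ) r = R at *
    rw [pow_succ]
    generalize (-(β * δ)) ^ r = B at *
    field_simp
    rw [hadd]
    ring

/-- The recursion produced by slicing at the first variable. The factor q^r appears because dropping
the first index lowers the positions of the other r indices by one. -/
theorem coef_first (hq : qpar α β γ δ ≠ 0) {d : ℕ} (hd : ∀ m ≤ d, den α β γ δ m ≠ 0) {r : ℕ}
    (hr : r ≤ d) :
    qpar α β γ δ ^ r * (β * coef α β γ δ (d + 1) r - α * coef α β γ δ (d + 1) (r + 1)) =
      β * coef α β γ δ d r - if r = 0 then α else 0 := by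
  have h0 := hd d le_rfl
  obtain _ | r := r
  · have hc1 : coef α β γ δ (d + 1) (0 + 1) = 1 / den α β γ δ d := by
      simp [coef, qfact]
    have hc0 : coef α β γ δ (d + 1) 0 = coef α β γ δ d 0 +
        -(α * γ) * (qint (qpar α β γ δ) d / den α β γ δ d) := by
      rw [coef, Finset.sum_range_succ, mul_add, ← coef]
    rw [hc1, hc0, if_pos rfl]
    field_simp
    simp only [den]
    ring
  · have hr' := hd (d - (r + 1)) (by omega)
    have hP : ∏ p ∈ Finset.range (r + 1), den α β γ δ (d - 1 - p) ≠ 0 :=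
      Finset.prod_ne_zero_iff.mpr fun p _ => hd _ (by omega)
    have hadd : den α β γ δ d = qpar α β γ δ ^ (r + 1) * den α β γ δ (d - (r + 1)) +
        α * δ * qint (qpar α β γ δ) (r + 1) := by
      have h1 := qint_add (qpar α β γ δ) (r + 1) (d - (r + 1))
      rw [Nat.add_sub_cancel' hr] at h1
      have h2 := sub_one_mul_qint (qpar α β γ δ) (r + 1)
      have h3 : α * δ = 1 + β * γ - qpar α β γ δ := by simp only [qpar]; ring
      simp only [den, h1, h3]
      linear_combination h2
    rw [coef_succ_succ, coef_succ _ _ hr', if_neg (by omega), coef]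
    generalize ∏ p ∈ Finset.range (r + 1), den α β γ δ (d - 1 - p) = P at *
    have hqr := pow_ne_zero (r + 1) hq
    have hqr' := pow_ne_zero ((r + 1) * r / 2) hq
    generalize qpar α β γ δ ^ ((r + 1) * r / 2) = Q1 at *
    generalize qpar α β γ δ ^ (r + 1) = Q2 at *
    generalize qint (qpar α β γ δ) (r + 1) = I at *
    generalize den α β γ δ (d - (r + 1)) = D at *
    generalize den α β γ δ d = E at *
    generalize qfact (qpar α β γ δ) r = R at *
    rw [pow_succ]
    generalize (-(β * δ)) ^ r = B at *
    field_simp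
    rw [hadd]
    ring

/-! ### Expansion of the sum of the variables of one block. -/

variable (α β γ δ)

/-- The sum of the variables `e^{-v_k}` with `p ≤ k < e`. -/
def zsum (n p e' : ℕ) : GrpAlg n := ∑ k ∈ blk n p e', e (-v k)

/-- The power of `q` given by the positions of the elements of `J` counted from `p`. -/
def qpos {n : ℕ} (p : ℕ) (J : Finset (Fin (n + 1))) : ℂ :=
  qpar α β γ δ ^ ∑ j ∈ J, (j.val - p)

/-- The sum of the elements of `blockFam` with the coefficients of the discrete Hamiltonian. -/
def famSum (n p e' : ℕ) (c : ℕ → ℂ) : GrpAlg n :=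
  ∑ J ∈ (blk n p e').powerset, (c J.card * qpos α β γ δ p J) • blockFam α β γ δ e' J

theorem qpos_insert {n p : ℕ} {J : Finset (Fin (n + 1))} {k : Fin (n + 1)} (h : k ∉ J) :
    qpos α β γ δ p (insert k J) = qpar α β γ δ ^ (k.val - p) * qpos α β γ δ p J := by
  rw [qpos, Finset.sum_insert h, pow_add, qpos]

/-- Group the subsets in pairs J, J ∪ {m}: both members slice to multiples of the same element of
the shorter family. -/
theorem slice_famSum_last {n p : ℕ} (m : Fin (n + 1)) (hp : p ≤ m.val) (c : ℕ → ℂ) :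
    slice δ (-γ) m (famSum α β γ δ n p (m.val + 1) c) = famSum α β γ δ n p m.val fun r =>
      δ * c r - γ * qpar α β γ δ ^ (m.val - p) * c (r + 1) := by
  rw [famSum, blk_succ_right hp, Finset.sum_powerset_insert notMem_blk_right,
    ← Finset.sum_add_distrib, map_sum, famSum]
  refine Finset.sum_congr rfl fun J hJ => ?_
  rw [Finset.mem_powerset] at hJ
  have hm : m ∉ J := fun h => notMem_blk_right (hJ h)
  have hJ0 : J ⊆ blk n 0 m.val := fun k hk => by
    have := mem_blk.mp (hJ hk)
    rw [mem_blk]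
    omega
  rw [map_add, map_smul, map_smul, slice_blockFam_last α β γ δ m hJ0,
    slice_blockFam_insert_last α β γ δ m hJ0, Finset.card_insert_of_notMem hm,
    qpos_insert _ _ _ _ hm]
  module

theorem slice_famSum_first {n e' : ℕ} (p : Fin (n + 1)) (hp : p.val + 1 ≤ e') (he : e' ≤ n + 1)
    (c : ℕ → ℂ) :
    slice β (-α) p (famSum α β γ δ n p.val e' c) = famSum α β γ δ n (p.val + 1) e' fun r =>
      qpar α β γ δ ^ r * (β * c r - α * c (r + 1)) := by
  rw [famSum, blk_succ_left hp, Finset.sum_powerset_insert notMem_blk_left,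
    ← Finset.sum_add_distrib, map_sum, famSum]
  refine Finset.sum_congr rfl fun J hJ => ?_
  rw [Finset.mem_powerset] at hJ
  have hm : p ∉ J := fun h => notMem_blk_left (hJ h)
  have hpos : qpos α β γ δ p.val J =
      qpar α β γ δ ^ J.card * qpos α β γ δ (p.val + 1) J := by
    rw [qpos, qpos, ← pow_add, Finset.card_eq_sum_ones, ← Finset.sum_add_distrib]
    congr 1
    refine Finset.sum_congr rfl fun k hk => ?_
    have := mem_blk.mp (hJ hk)
    omega
  rw [map_add, map_smul, map_smul, slice_blockFam_first α β γ δ p hp hJ,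
    slice_blockFam_insert_first α β γ δ p hp he hJ, Finset.card_insert_of_notMem hm,
    qpos_insert _ _ _ _ hm, hpos, Nat.sub_self, pow_zero]
  module

theorem sg_blockFam {n e' : ℕ} {i : Fin n} (hi : i.val + 1 < e') {J : Finset (Fin (n + 1))}
    (hJ : i.castSucc ∈ J ↔ i.succ ∈ J) :
    sg i (blockFam α β γ δ e' J) = blockFam α β γ δ e' J := by
  refine sg_of_Tcheck_eq α β γ δ ?_
  rw [Tcheck_blockFam α β γ δ hi hJ.mp, sw_eq_self hJ]

/-- Sets containing both neighbours or neither give s_i-invariant elements. Of the sets J ∪ {i} and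
J ∪ {i + 1} the second carries an extra factor q, and Ť_i sends its element to that of the first, so
their sum is invariant by `sg_Tcheck_add`. -/
theorem sg_famSum {n p e' : ℕ} (c : ℕ → ℂ) {i : Fin n} (hp : p ≤ i.val) (hi : i.val + 1 < e') :
    sg i (famSum α β γ δ n p e' c) = famSum α β γ δ n p e' c := by
  have hne := (Fin.castSucc_lt_succ (i := i)).ne
  obtain ⟨B, hB, hB1, hB2⟩ : ∃ B, blk n p e' = insert i.castSucc (insert i.succ B) ∧
      i.castSucc ∉ B ∧ i.succ ∉ B := by
    refine ⟨((blk n p e').erase i.castSucc).erase i.succ, ?_, by simp, by simp⟩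
    rw [Finset.insert_erase, Finset.insert_erase]
    · rw [mem_blk, Fin.val_castSucc]; omega
    · rw [Finset.mem_erase, mem_blk, Fin.val_succ]; exact ⟨hne.symm, by omega, by omega⟩
  rw [famSum, hB, Finset.sum_powerset_insert (by simp [hB1, hne]),
    Finset.sum_powerset_insert hB2, Finset.sum_powerset_insert hB2]
  simp only [← Finset.sum_add_distrib, map_sum]
  refine Finset.sum_congr rfl fun J hJ => ?_
  rw [Finset.mem_powerset] at hJ
  have h1 : i.castSucc ∉ J := fun h => hB1 (hJ h)
  have h2 : i.succ ∉ J := fun h => hB2 (hJ h)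
  have h3 : i.castSucc ∉ insert i.succ J := by simp [h1, hne]
  have hs0 : sw i J = J := sw_eq_self (by simp [h1, h2])
  have hT : Tcheck α β γ δ i (blockFam α β γ δ e' (insert i.succ J)) =
      blockFam α β γ δ e' (insert i.castSucc J) := by
    rw [Tcheck_blockFam α β γ δ hi (by simp), sw_insert, hs0, s_succ]
  have hsym := sg_Tcheck_add α β γ δ i (blockFam α β γ δ e' (insert i.succ J))
  rw [hT] at hsym
  have hpow : qpar α β γ δ ^ (i.succ.val - p) =
      qpar α β γ δ ^ (i.castSucc.val - p) * qpar α β γ δ := by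
    rw [← pow_succ, Fin.val_succ, Fin.val_castSucc]
    congr 1
    omega
  rw [Finset.card_insert_of_notMem h2, Finset.card_insert_of_notMem h1,
    Finset.card_insert_of_notMem h3, Finset.card_insert_of_notMem h2,
    qpos_insert _ _ _ _ h3, qpos_insert _ _ _ _ h2, qpos_insert _ _ _ _ h1, hpow]
  simp only [map_add, map_smul] at hsym ⊢
  rw [sg_blockFam α β γ δ hi (J := J) (by simp [h1, h2]),
    sg_blockFam α β γ δ hi (J := insert i.castSucc (insert i.succ J)) (by simp)]
  linear_combination (norm := module) (c (J.card + 1) * (qpar α β γ δ ^ (i.castSucc.val - p) *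
    qpos α β γ δ p J)) • hsym

theorem sg_zsum {n p e' : ℕ} {i : Fin n} (hp : p ≤ i.val) (hi : i.val + 1 < e') :
    sg i (zsum n p e') = zsum n p e' := by
  rw [zsum, map_sum]
  refine Finset.sum_equiv (s i) (fun k => ?_) fun k _ => ?_
  · rw [mem_blk, mem_blk, s_val]
    split_ifs <;> omega
  · rw [sg_e, act_neg, act_v]

theorem slice_zsum_insert (a b : ℂ) {n : ℕ} {m : Fin (n + 1)} {B : Finset (Fin (n + 1))}
    (hm : m ∉ B) : slice a b m (∑ k ∈ insert m B, e (-v k)) = a • ∑ k ∈ B, e (-v k) + b • 1 := by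
  rw [Finset.sum_insert hm, map_add, slice_z, map_sum, Finset.smul_sum, add_comm]
  congr 1
  refine Finset.sum_congr rfl fun k hk => slice_z_of_ne _ _ fun h => hm (h ▸ hk)

theorem zsum_mem_cube (n p e' : ℕ) : zsum n p e' ∈ cube n := by
  refine sum_mem fun k _ => e_mem_cube fun j => ?_
  by_cases h : j = k
  · subst h; simp [v]
  · simp [v, h]

theorem famSum_mem_cube (n p e' : ℕ) (c : ℕ → ℂ) : famSum α β γ δ n p e' c ∈ cube n := by
  refine sum_mem fun J hJ => Submodule.smul_mem _ _ (blockFam_mem_cube α β γ δ fun k hk => ?_)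
  have := mem_blk.mp (Finset.mem_powerset.mp hJ hk)
  rw [mem_blk]
  omega

theorem famSum_sub_ite {n p e' : ℕ} (c : ℕ → ℂ) (a : ℂ) :
    famSum α β γ δ n p e' (fun r => c r - if r = 0 then a else 0) =
      famSum α β γ δ n p e' c - a • 1 := by
  have h : famSum α β γ δ n p e' (fun r => if r = 0 then a else 0) = a • 1 := by
    rw [famSum, Finset.sum_eq_single ∅]
    · simp [qpos, blockFam_empty]
    · intro J _ hJ
      simp [hJ]
    · simp
  rw [← h]
  simp only [famSum, sub_mul, sub_smul, Finset.sum_sub_distrib]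

theorem famSum_mul_left {n p e' : ℕ} (c : ℕ → ℂ) (a : ℂ) :
    famSum α β γ δ n p e' (fun r => a * c r) = a • famSum α β γ δ n p e' c := by
  simp only [famSum, Finset.smul_sum, smul_smul, mul_assoc]

theorem famSum_congr {n p e' : ℕ} {c c' : ℕ → ℂ} (h : ∀ r ≤ e' - p, c r = c' r) :
    famSum α β γ δ n p e' c = famSum α β γ δ n p e' c' := by
  refine Finset.sum_congr rfl fun J hJ => ?_
  rw [h]
  refine (Finset.card_le_card (Finset.mem_powerset.mp hJ)).trans ?_
  calc (blk n p e').card = ((blk n p e').map Fin.valEmbedding).card := (Finset.card_map _).symm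
    _ ≤ (Finset.Ico p e').card := by
      refine Finset.card_le_card fun k hk => ?_
      obtain ⟨j, hj, rfl⟩ := Finset.mem_map.mp hk
      exact Finset.mem_Ico.mpr (mem_blk.mp hj)
    _ = e' - p := Nat.card_Ico _ _

/-- The expansion of the sum of the variables of a block, for `q ≠ 1`. -/
theorem zsum_eq_famSum_of_ne_one (hq : qpar α β γ δ ≠ 0) (hq1 : α * δ - β * γ ≠ 0) {n p : ℕ}
    (d : ℕ) (hd : ∀ m < d, den α β γ δ m ≠ 0) (hpd : p + d ≤ n + 1) :
    zsum n p (p + d) = famSum α β γ δ n p (p + d) (coef α β γ δ d) := by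
  induction d generalizing p with
  | zero =>
    have : blk n p p = ∅ := Finset.filter_eq_empty_iff.mpr fun k _ => by omega
    simp [zsum, famSum, this, coef]
  | succ d ih =>
    have hd' : ∀ m ≤ d, den α β γ δ m ≠ 0 := fun m hm => hd m (by omega)
    have ih' := fun p => ih (p := p) fun m hm => hd m (by omega)
    rw [← sub_eq_zero]
    -- The difference is multilinear and symmetric in the block; two independent slices of it at a
    -- single variable have to vanish.
    set Q := zsum n p (p + (d + 1)) - famSum α β γ δ n p (p + (d + 1)) (coef α β γ δ (d + 1))
      with hQ
    have hcube : Q ∈ cube n := sub_mem (zsum_mem_cube _ _ _) (famSum_mem_cube _ _ _ _ _ _ _ _)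
    have hsg : ∀ i : Fin n, p ≤ i.val → i.val + 1 < p + (d + 1) → sg i Q = Q := by
      intro i h1 h2
      rw [hQ, map_sub, sg_zsum h1 h2, sg_famSum α β γ δ _ h1 h2]
    have hfirst : slice β (-α) ⟨p, by omega⟩ Q = 0 := by
      have h1 := slice_famSum_first α β γ δ (n := n) (e' := p + (d + 1)) ⟨p, by omega⟩
        (by simp only; omega) hpd (coef α β γ δ (d + 1))
      have h2 := slice_zsum_insert β (-α) (notMem_blk_left (n := n) (e := p + (d + 1))
        (p := ⟨p, by omega⟩))
      rw [← blk_succ_left (by simp only; omega)] at h2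
      have h3 := ih' (p + 1) (by omega)
      simp only at h1 h2
      rw [famSum_congr α β γ δ fun r hr => coef_first hq hd' (by omega), famSum_sub_ite,
        famSum_mul_left, show p + (d + 1) = p + 1 + d by omega, ← h3] at h1
      rw [hQ, map_sub, zsum, h2, show p + (d + 1) = p + 1 + d by omega, h1, zsum]
      module
    have hlast : slice δ (-γ) ⟨p + d, by omega⟩ Q = 0 := by
      have h1 := slice_famSum_last α β γ δ (n := n) (p := p) ⟨p + d, by omega⟩
        (by simp only; omega) (coef α β γ δ (d + 1))
      have h2 := slice_zsum_insert δ (-γ) (notMem_blk_right (n := n) (p := p)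
        (m := ⟨p + d, by omega⟩))
      rw [← blk_succ_right (by simp only; omega)] at h2
      have h3 := ih' p (by omega)
      simp only [Nat.add_sub_cancel_left] at h1 h2
      rw [famSum_congr α β γ δ fun r hr => coef_last hq hd' (by omega), famSum_sub_ite,
        famSum_mul_left, ← h3] at h1
      rw [hQ, map_sub, zsum, ← add_assoc, h2, h1, zsum]
      module
    -- Symmetry carries the slice at the last variable, step by step, to the first, where the other
    -- slice is already known to vanish.
    have hall : ∀ t, t ≤ d → ∀ h : p + d - t < n + 1, slice δ (-γ) ⟨p + d - t, h⟩ Q = 0 := by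
      intro t
      induction t with
      | zero => intro _ _; exact hlast
      | succ t iht =>
        intro ht h
        have h1 := iht (by omega) (by omega)
        have hi : p + d - (t + 1) < n := by omega
        have e1 : (⟨p + d - t, by omega⟩ : Fin (n + 1)) = (⟨p + d - (t + 1), hi⟩ : Fin n).succ := by
          rw [Fin.ext_iff]; simp only [Fin.val_succ]; omega
        have e2 : (⟨p + d - (t + 1), h⟩ : Fin (n + 1)) =
            (⟨p + d - (t + 1), hi⟩ : Fin n).castSucc := rfl
        rw [e1, ← hsg ⟨p + d - (t + 1), hi⟩ (by simp only; omega) (by simp only; omega),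
          slice_sg, s_succ] at h1
        rw [e2, ← sg_sg ⟨p + d - (t + 1), hi⟩ (slice _ _ _ Q), h1, map_zero]
    refine eq_zero_of_slice α β γ δ hcube hq1 (m := ⟨p, by omega⟩) ?_ hfirst
    have := hall d le_rfl (by omega)
    simpa using this

end Params

/-! ### Removal of the restriction q ≠ 1 by continuity in the parameters. -/

section

theorem pairing_ext {n : ℕ} {P Q : GrpAlg n} (h : ∀ f, pairing P f = pairing Q f) : P = Q := by
  have key : ∀ (R : GrpAlg n) (x : Lat n), pairing R (Pi.single x 1) = R.coeff x := by
    intro R x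
    change Finsupp.linearCombination ℂ _ R.coeff = _
    rw [Finsupp.linearCombination_apply, Finsupp.sum]
    simp only [Pi.single_apply, smul_eq_mul, mul_ite, mul_one, mul_zero]
    simpa using fun h => h.symm
  ext x
  rw [← key, ← key, h]

theorem pairing_e_mul {n : ℕ} (w : Lat n) (P : GrpAlg n) (f : Fun n) :
    pairing (e w * P) f = pairing P fun x => f (w + x) :=
  eq_of_forall_e (A := extend f ∘ₗ LinearMap.mulLeft ℂ (e w)) (B := extend fun x => f (w + x))
    (fun x => by simp [← e_add]) P

theorem pairing_add {n : ℕ} (P Q : GrpAlg n) (f : Fun n) :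
    pairing (P + Q) f = pairing P f + pairing Q f := map_add (extend f) P Q

theorem pairing_smul {n : ℕ} (c : ℂ) (P : GrpAlg n) (f : Fun n) :
    pairing (c • P) f = c * pairing P f := map_smul (extend f) c P

theorem pairing_sum {n : ℕ} {ι : Type*} (t : Finset ι) (P : ι → GrpAlg n) (f : Fun n) :
    pairing (∑ i ∈ t, P i) f = ∑ i ∈ t, pairing (P i) f := map_sum (extend f) P t

section Continuity

variable {X : Type*} [TopologicalSpace X]

theorem continuous_pairing {n : ℕ} (P : GrpAlg n) {g : X → Fun n}
    (hg : ∀ x, Continuous fun t => g t x) : Continuous fun t => pairing P (g t) := by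
  have h : ∀ t, pairing P (g t) = ∑ x ∈ P.coeff.support, P.coeff x * g t x := by
    intro t
    change Finsupp.linearCombination ℂ _ P.coeff = _
    rw [Finsupp.linearCombination_apply, Finsupp.sum]
    rfl
  simp only [h]
  exact continuous_finsetSum _ fun x _ => continuous_const.mul (hg x)

variable {α β γ δ : X → ℂ} (hα : Continuous α) (hβ : Continuous β) (hγ : Continuous γ)
  (hδ : Continuous δ)

include hα hβ hγ hδ

theorem continuous_That {n : ℕ} (i : Fin n) {g : X → Fun n}
    (hg : ∀ x, Continuous fun t => g t x) (x : Lat n) :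
    Continuous fun t => That (α t) (β t) (γ t) (δ t) i (g t) x := by
  have h : ∀ t, That (α t) (β t) (γ t) (δ t) i (g t) x =
      pairing (rightAct (s i) (e x)) (g t) +
      (α t * γ t) * pairing (e (v i.castSucc + v i.succ) * divDiff i (e x)) (g t) +
      (α t * δ t) * pairing (e (v i.castSucc) * divDiff i (e x)) (g t) +
      (β t * γ t) * pairing (e (v i.succ) * divDiff i (e x)) (g t) +
      (β t * δ t) * pairing (divDiff i (e x)) (g t) := by
    intro t
    simp only [← pairing_smul, ← pairing_add]
    change pairing (Tcheck (α t) (β t) (γ t) (δ t) i (e x)) (g t) = _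
    congr 1
    simp only [Tcheck, LinearMap.add_apply, LinearMap.comp_apply, LinearMap.mulLeft_apply, e_add,
      Algebra.smul_def, map_mul]
    ring
  simp only [h]
  have hc := fun P => continuous_pairing (n := n) P hg
  exact ((((hc _).add ((hα.mul hγ).mul (hc _))).add ((hα.mul hδ).mul (hc _))).add
    ((hβ.mul hγ).mul (hc _))).add ((hβ.mul hδ).mul (hc _))

theorem continuous_prod_That {n : ℕ} (l : List (Fin n)) (f : Fun n) (x : Lat n) :
    Continuous fun t => (l.map (That (α t) (β t) (γ t) (δ t))).prod f x := by
  induction l generalizing x with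
  | nil => simpa using continuous_const
  | cons i l ih =>
    simp only [List.map_cons, List.prod_cons, Module.End.mul_apply]
    exact continuous_That hα hβ hγ hδ i ih x

/-- The sorting word depends only on the lattice point, so the parameters enter through a fixed
finite product of operators. -/
theorem continuous_blockFam {n : ℕ} (e' : ℕ) (J : Finset (Fin (n + 1))) (f : Fun n) :
    Continuous fun t => pairing (blockFam (α t) (β t) (γ t) (δ t) e' J) f := by
  simp only [blockFam, propag, pairing_e_mul, pairing_alongPath]
  exact continuous_prod_That hα hβ hγ hδ _ _ _

theorem continuous_qpar : Continuous fun t => qpar (α t) (β t) (γ t) (δ t) :=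
  (continuous_const.add (hβ.mul hγ)).sub (hα.mul hδ)

theorem continuous_qint (m : ℕ) : Continuous fun t => qint (qpar (α t) (β t) (γ t) (δ t)) m :=
  continuous_finsetSum _ fun _ _ => (continuous_qpar hα hβ hγ hδ).pow _

theorem continuous_den (m : ℕ) : Continuous fun t => den (α t) (β t) (γ t) (δ t) m :=
  continuous_const.add ((hβ.mul hγ).mul (continuous_qint hα hβ hγ hδ m))

theorem continuousAt_coef {t₀ : X} {d : ℕ}
    (hq : qpar (α t₀) (β t₀) (γ t₀) (δ t₀) ≠ 0)
    (hd : ∀ m < d, den (α t₀) (β t₀) (γ t₀) (δ t₀) m ≠ 0) (r : ℕ) :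
    ContinuousAt (fun t => coef (α t) (β t) (γ t) (δ t) d r) t₀ := by
  have cden := fun m => (continuous_den hα hβ hγ hδ m).continuousAt (x := t₀)
  have cint := fun m => (continuous_qint hα hβ hγ hδ m).continuousAt (x := t₀)
  have cq := (continuous_qpar hα hβ hγ hδ).continuousAt (x := t₀)
  obtain _ | r := r
  · refine ContinuousAt.mul (hα.mul hγ).neg.continuousAt ?_
    refine tendsto_finsetSum _ fun j hj => ?_
    exact (cint j).div (cden j) (hd j (Finset.mem_range.mp hj))
  -- The alternative m = 0 covers the truncated difference d - 1 - p when d = 0.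
  · have hden : ∀ m, m < d ∨ m = 0 → den (α t₀) (β t₀) (γ t₀) (δ t₀) m ≠ 0 := by
      rintro m (h | rfl)
      · exact hd m h
      · simp [den, qint]
    have cfact : ContinuousAt (fun t => qfact (qpar (α t) (β t) (γ t) (δ t)) r) t₀ :=
      tendsto_finsetProd _ fun j _ => cint (j + 1)
    refine ContinuousAt.div (((hβ.mul hδ).neg.pow r).continuousAt.mul cfact |>.mul
      ((cq.pow _).inv₀ (pow_ne_zero _ hq))) ?_ ?_
    · exact tendsto_finsetProd _ fun p _ => cden _
    · exact Finset.prod_ne_zero_iff.mpr fun p _ => hden _ (by omega)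

theorem continuousAt_famSum {t₀ : X} {n p e' d : ℕ}
    (hq : qpar (α t₀) (β t₀) (γ t₀) (δ t₀) ≠ 0)
    (hd : ∀ m < d, den (α t₀) (β t₀) (γ t₀) (δ t₀) m ≠ 0) (f : Fun n) :
    ContinuousAt (fun t => pairing (famSum (α t) (β t) (γ t) (δ t) n p e'
      (coef (α t) (β t) (γ t) (δ t) d)) f) t₀ := by
  simp only [famSum, pairing_sum, pairing_smul]
  refine tendsto_finsetSum _ fun J _ => ?_
  exact ((continuousAt_coef hα hβ hγ hδ hq hd _).mul
    ((continuous_qpar hα hβ hγ hδ).pow _).continuousAt).mul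
    (continuous_blockFam hα hβ hγ hδ e' J f).continuousAt

end Continuity

variable {α β γ δ : ℂ}

-- The expression equals αδ - βγ + t (α + δ + t), a nonconstant polynomial in t, so its zeros do not
-- accumulate at 0. Shifting α and δ together works even where both vanish.
open Filter Topology in
theorem eventually_ne_of_shift (α β γ δ : ℂ) :
    ∀ᶠ t : ℂ in 𝓝[≠] 0, (α + t) * (δ + t) - β * γ ≠ 0 := by
  by_cases h : α * δ - β * γ = 0
  · have h1 : ∀ᶠ t : ℂ in 𝓝[≠] 0, t ≠ 0 := eventually_mem_nhdsWithin
    have h2 : ∀ᶠ t : ℂ in 𝓝[≠] 0, α + δ + t ≠ 0 := by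
      by_cases h3 : α + δ = 0
      · simpa [h3] using h1
      · refine eventually_nhdsWithin_of_eventually_nhds (ContinuousAt.eventually_ne ?_ ?_)
        · fun_prop
        · simpa using h3
    filter_upwards [h1, h2] with t ht1 ht2 h0
    have : t * (α + δ + t) = 0 := by linear_combination h0 - h
    exact (mul_ne_zero ht1 ht2) this
  · refine eventually_nhdsWithin_of_eventually_nhds (ContinuousAt.eventually_ne ?_ ?_)
    · fun_prop
    · simpa using h

open Filter Topology in
/-- The expansion of the sum of the variables of a block. -/
theorem zsum_eq_famSum (hq : qpar α β γ δ ≠ 0) {n p : ℕ} (d : ℕ)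
    (hd : ∀ m < d, den α β γ δ m ≠ 0) (hpd : p + d ≤ n + 1) :
    zsum n p (p + d) = famSum α β γ δ n p (p + d) (coef α β γ δ d) := by
  refine pairing_ext fun f => ?_
  have hα : Continuous fun t : ℂ => α + t := by fun_prop
  have hβ : Continuous fun _ : ℂ => β := continuous_const
  have hγ : Continuous fun _ : ℂ => γ := continuous_const
  have hδ : Continuous fun t : ℂ => δ + t := by fun_prop
  have hq0 : qpar (α + 0) β γ (δ + 0) ≠ 0 := by simpa using hq
  have hd0 : ∀ m < d, den (α + 0) β γ (δ + 0) m ≠ 0 := by simpa using hd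
  have hc : ContinuousAt (fun t : ℂ => pairing (famSum (α + t) β γ (δ + t) n p (p + d)
      (coef (α + t) β γ (δ + t) d)) f) 0 := continuousAt_famSum hα hβ hγ hδ hq0 hd0 f
  have hev : ∀ᶠ t : ℂ in 𝓝[≠] 0, pairing (famSum (α + t) β γ (δ + t) n p (p + d)
      (coef (α + t) β γ (δ + t) d)) f = pairing (zsum n p (p + d)) f := by
    have e1 : ∀ᶠ t : ℂ in 𝓝[≠] 0, qpar (α + t) β γ (δ + t) ≠ 0 :=
      eventually_nhdsWithin_of_eventually_nhds
        ((continuous_qpar hα hβ hγ hδ).continuousAt.eventually_ne hq0)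
    have e2 : ∀ᶠ t : ℂ in 𝓝[≠] 0, ∀ m ∈ Finset.range d, den (α + t) β γ (δ + t) m ≠ 0 := by
      rw [Filter.eventually_all_finset]
      exact fun m hm => eventually_nhdsWithin_of_eventually_nhds
        ((continuous_den hα hβ hγ hδ m).continuousAt.eventually_ne
          (hd0 m (Finset.mem_range.mp hm)))
    filter_upwards [e1, e2, eventually_ne_of_shift α β γ δ] with t h1 h2 h3
    rw [zsum_eq_famSum_of_ne_one _ _ _ _ h1 h3 d (fun m hm => h2 m (Finset.mem_range.mpr hm)) hpd]
  -- The sum of the z_k does not involve the parameters, so the expansion is constant near t = 0 and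
  -- its limit at 0 is its value there.
  have h1 := hc.tendsto.mono_left (nhdsWithin_le_nhds (s := {0}ᶜ))
  have h2 := tendsto_nhds_unique (h1.congr' hev) tendsto_const_nhds
  simpa using h2.symm

end

/-! ### From one block to all lattice points. -/

/-- The set of indices of the coordinates of `x` with value `c`. -/
def level {n : ℕ} (x : Lat n) (c : ℤ) : Finset (Fin (n + 1)) := Finset.univ.filter fun k => x k = c

theorem mem_level {n : ℕ} {x : Lat n} {c : ℤ} {k : Fin (n + 1)} : k ∈ level x c ↔ x k = c := by
  simp [level]

theorem sum_level {n : ℕ} (x : Lat n) {M : Type*} [AddCommMonoid M] (φ : Fin (n + 1) → M) :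
    ∑ c ∈ Finset.univ.image x, ∑ k ∈ level x c, φ k = ∑ k, φ k :=
  Finset.sum_fiberwise_of_maps_to (fun _ hk => Finset.mem_image_of_mem x hk) φ

theorem mem_iff_lt_card {n : ℕ} {S : Finset (Fin (n + 1))} (hS : ∀ k ∈ S, ∀ l ≤ k, l ∈ S)
    (k : Fin (n + 1)) : k ∈ S ↔ k.val < S.card := by
  constructor
  · intro hk
    have h : Finset.Iic k ⊆ S := fun l hl => hS k hk l (Finset.mem_Iic.mp hl)
    have := Finset.card_le_card h
    rw [Fin.card_Iic] at this
    omega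
  · intro hk
    by_contra hc
    have h : S ⊆ Finset.Iio k := fun l hl => Finset.mem_Iio.mpr
      (lt_of_not_ge fun hkl => hc (hS l hl k hkl))
    have := Finset.card_le_card h
    rw [Fin.card_Iio] at this
    omega

theorem card_blk {n p e' : ℕ} (he : e' ≤ n + 1) : (blk n p e').card = e' - p := by
  rw [← Finset.card_map Fin.valEmbedding, ← Nat.card_Ico]
  congr 1
  ext k
  simp only [Finset.mem_map, mem_blk, Fin.valEmbedding_apply, Finset.mem_Ico]
  constructor
  · rintro ⟨j, hj, rfl⟩
    exact hj
  · intro hk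
    exact ⟨⟨k, by omega⟩, hk, rfl⟩

/-- The endpoints p and p + d count the coordinates greater than c and those at least c; for
dominant x both sets of indices are initial segments. The interval is empty when c is not a value of
x. -/
theorem exists_level_eq_blk {n : ℕ} {x : Lat n} (hx : Dominant x) (c : ℤ) :
    ∃ p d : ℕ, p + d ≤ n + 1 ∧ level x c = blk n p (p + d) ∧
      ∀ k : Fin (n + 1), p + d ≤ k.val → x k < c := by
  rw [dominant_iff_antitone] at hx
  have h1 := mem_iff_lt_card (S := Finset.univ.filter fun k => c < x k) (by
    intro k hk l hl
    simp only [Finset.mem_filter, Finset.mem_univ, true_and] at hk ⊢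
    exact hk.trans_le (hx hl))
  have h2 := mem_iff_lt_card (S := Finset.univ.filter fun k => c ≤ x k) (by
    intro k hk l hl
    simp only [Finset.mem_filter, Finset.mem_univ, true_and] at hk ⊢
    exact hk.trans (hx hl))
  have h3 : (Finset.univ.filter fun k => c < x k).card ≤
      (Finset.univ.filter fun k => c ≤ x k).card :=
    Finset.card_le_card fun k hk => by
      simp only [Finset.mem_filter, Finset.mem_univ, true_and] at hk ⊢
      exact hk.le
  have h4 := Finset.card_le_univ (Finset.univ.filter fun k => c ≤ x k)
  rw [Fintype.card_fin] at h4
  simp only [Finset.mem_filter, Finset.mem_univ, true_and] at h1 h2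
  refine ⟨_, _, (Nat.add_sub_cancel' h3).trans_le h4, ?_, ?_⟩
  · ext k
    rw [mem_level, mem_blk, Nat.add_sub_cancel' h3, ← not_lt, ← h1, ← h2, not_lt]
    exact ⟨fun h => ⟨h.le, h.ge⟩, fun h => le_antisymm h.1 h.2⟩
  · intro k hk
    rw [Nat.add_sub_cancel' h3, ← not_lt, ← h2, not_le] at hk
    exact hk

theorem dminus_eq {n p e' : ℕ} {x : Lat n} {c : ℤ} (h : level x c = blk n p e')
    {j : Fin (n + 1)} (hj : j ∈ level x c) : dminus j x = j.val - p := by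
  rw [← card_blk (n := n) (p := p) (e' := j.val) j.isLt.le, dminus]
  congr 1
  ext k
  have hk : x k = c ↔ p ≤ k.val ∧ k.val < e' := by rw [← mem_level, h, mem_blk]
  have hjc := mem_level.mp hj
  rw [h, mem_blk] at hj
  rw [Finset.mem_filter, mem_blk, hjc, hk, Fin.lt_def]
  simp only [Finset.mem_univ, true_and]
  omega

theorem level_act {n : ℕ} (i : Fin n) (x : Lat n) (c : ℤ) :
    level (act (s i) x) c = sw i (level x c) := by
  ext k
  rw [mem_level, mem_sw, mem_level, act_s_apply]

theorem image_act {n : ℕ} (i : Fin n) (x : Lat n) :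
    Finset.univ.image (act (s i) x) = Finset.univ.image x := by
  ext c
  simp only [Finset.mem_image, Finset.mem_univ, true_and, act_s_apply]
  exact ⟨fun ⟨k, hk⟩ => ⟨s i k, hk⟩, fun ⟨k, hk⟩ => ⟨s i k, by rwa [s_s]⟩⟩

/-- Exchanging neighbours with different values preserves the order of indices inside each level
set. -/
theorem dminus_act {n : ℕ} {i : Fin n} {x : Lat n} (hx : root i x ≠ 0) (j : Fin (n + 1)) :
    dminus (s i j) (act (s i) x) = dminus j x := by
  have hx' : x i.castSucc ≠ x i.succ := fun h => hx (by rw [root, h, sub_self])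
  rw [dminus, dminus, ← Finset.card_map (s i).toEmbedding]
  congr 1
  ext k
  rw [Finset.mem_map_equiv, show (s i).symm k = s i k from by rw [Equiv.symm_apply_eq, s_s]]
  simp only [Finset.mem_filter, Finset.mem_univ, true_and, act_s_apply, s_s]
  by_cases h : x k = x j
  · have h1 : ¬ (k = i.castSucc ∧ j = i.succ) := by rintro ⟨rfl, rfl⟩; exact hx' h
    have h2 : ¬ (k = i.succ ∧ j = i.castSucc) := by rintro ⟨rfl, rfl⟩; exact hx' h.symm
    refine and_congr_left fun _ => ?_
    simp only [Fin.ext_iff, Fin.val_castSucc, Fin.val_succ] at h1 h2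
    rw [Fin.lt_def, Fin.lt_def, s_val, s_val]
    split_ifs <;> omega
  · simp [h]

section Params

variable (α β γ δ : ℂ)

/-- The right hand side of the action of the discrete Hamiltonian, in terms of the level sets. -/
def levelSum {n : ℕ} {M : Type*} [AddCommMonoid M] [Module ℂ M] (φ : Lat n → M) (x : Lat n) : M :=
  ∑ c ∈ Finset.univ.image x, ∑ J ∈ (level x c).powerset,
    (coef α β γ δ (level x c).card J.card * qpar α β γ δ ^ ∑ j ∈ J, dminus j x) • φ (x - ind J)

variable {α β γ δ}

theorem zsum_mul_e (hq : qpar α β γ δ ≠ 0) {n : ℕ} (hd : ∀ m ≤ n, den α β γ δ m ≠ 0)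
    {x : Lat n} (hx : Dominant x) :
    (∑ k, e (-v k)) * e x = levelSum α β γ δ (propag α β γ δ) x := by
  rw [← sum_level x, Finset.sum_mul, levelSum]
  refine Finset.sum_congr rfl fun c _ => ?_
  obtain ⟨p, d, hpd, hlev, hlt⟩ := exists_level_eq_blk hx c
  have h := zsum_eq_famSum hq (n := n) (p := p) d (fun m hm => hd m (by omega)) hpd
  rw [hlev, ← zsum, h, famSum, Finset.sum_mul, card_blk hpd, Nat.add_sub_cancel_left]
  refine Finset.sum_congr rfl fun J hJ => ?_
  rw [Finset.mem_powerset] at hJ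
  rw [smul_mul_assoc, mul_comm _ (e x), e_mul_blockFam α β γ δ hx (c := c)
    (fun k hk => mem_level.mp (hlev ▸ hk)) hlt (Nat.le_add_right _ _) hJ, qpos]
  congr 3
  exact Finset.sum_congr rfl fun j hj => (dminus_eq hlev (hlev ▸ hJ hj)).symm

theorem sg_sum_z {n : ℕ} (i : Fin n) : sg i (∑ k, e (-v k)) = ∑ k, e (-v k) := by
  rw [map_sum]
  exact Fintype.sum_equiv (s i) _ _ fun k => by rw [sg_e, act_neg, act_v]

/-- Apply Ť_i to the identity at the better sorted point: it commutes with the symmetric factor on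
the left, and on the right it sends the term of J to that of s_i J with the same coefficient. -/
theorem zsum_mul_propag (hq : qpar α β γ δ ≠ 0) {n : ℕ} (hd : ∀ m ≤ n, den α β γ δ m ≠ 0)
    (x : Lat n) :
    (∑ k, e (-v k)) * propag α β γ δ x = levelSum α β γ δ (propag α β γ δ) x := by
  induction x using sort_induction with
  | dom x hx => rw [propag_of_dominant α β γ δ hx, zsum_mul_e hq hd hx]
  | step x ih hx =>
    obtain ⟨i, hi⟩ := hx
    have ih := ih _ (inv_act_s_lt hi)
    have hr : 0 < root i (act (s i) x) := by rw [root_act_s]; omega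
    obtain ⟨y, rfl⟩ : ∃ y, x = act (s i) y := ⟨act (s i) x, (act_s_act_s i x).symm⟩
    rw [act_s_act_s] at ih hr
    rw [propag_of_root_neg α β γ δ hi, act_s_act_s, ← Tcheck_mul α β γ δ (sg_sum_z i), ih,
      levelSum, levelSum, map_sum, image_act]
    refine Finset.sum_congr rfl fun c _ => ?_
    rw [map_sum, level_act]
    refine Finset.sum_bij (fun J _ => sw i J) (fun J hJ => ?_) (fun J _ J' _ h => ?_)
      (fun J hJ => ?_) (fun J hJ => ?_)
    · rw [Finset.mem_powerset] at hJ ⊢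
      exact Finset.map_subset_map.mpr hJ
    · exact Finset.map_injective _ h
    · rw [Finset.mem_powerset] at hJ
      refine ⟨sw i J, ?_, sw_sw i J⟩
      rw [Finset.mem_powerset, ← sw_sw i (level y c)]
      exact Finset.map_subset_map.mpr hJ
    · rw [map_smul, Tcheck_propag, act_sub, act_s_ind]
      · congr 2
        · rw [sw, sw, Finset.card_map, Finset.card_map]
        · congr 1
          rw [sw, Finset.sum_map]
          exact Finset.sum_congr rfl fun j _ => (dminus_act hr.ne' j).symm
      -- An integral difference that is positive is at least 1, so lowering the larger coordinate by
      -- one leaves it nonnegative, as `Tcheck_propag` requires.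
      · simp only [root, Pi.sub_apply, ind] at hr ⊢
        split_ifs <;> omega

/-! ### The discrete Hamiltonian in terms of level sets -/

/-- On a level set the count of larger elements is d⁺; this turns the potential term of H into a sum
over 0, …, d - 1 for each level of size d. -/
theorem sum_card_gt {ι M : Type*} [LinearOrder ι] [AddCommMonoid M] (φ : ℕ → M) (S : Finset ι) :
    ∑ k ∈ S, φ (S.filter fun p => k < p).card = ∑ j ∈ Finset.range S.card, φ j := by
  induction S using Finset.induction_on_min with
  | empty => simp
  | insert a S ha ih =>
    have hna : a ∉ S := fun h => lt_irrefl a (ha a h)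
    rw [Finset.sum_insert hna, Finset.card_insert_of_notMem hna, Finset.sum_range_succ, ← ih,
      add_comm]
    congr 1
    · refine Finset.sum_congr rfl fun k hk => ?_
      rw [Finset.filter_insert, if_neg (ha k hk).not_gt]
    · rw [Finset.filter_insert, if_neg (lt_irrefl a), Finset.filter_true_of_mem ha]

theorem dplus_eq {n : ℕ} {x : Lat n} {c : ℤ} {k : Fin (n + 1)} (hk : k ∈ level x c) :
    dplus k x = ((level x c).filter fun p => k < p).card := by
  rw [dplus, level, Finset.filter_filter, mem_level.mp hk]
  congr 1
  ext p
  simp only [Finset.mem_filter, Finset.mem_univ, true_and]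
  tauto

theorem dplus_add_dminus {n : ℕ} (k : Fin (n + 1)) (x : Lat n) :
    dplus k x + dminus k x = (level x (x k)).card - 1 := by
  have hk : k ∈ level x (x k) := mem_level.mpr rfl
  rw [← Finset.card_erase_of_mem hk, dplus, dminus, ← Finset.card_union_of_disjoint]
  · congr 1
    ext p
    simp only [Finset.mem_union, Finset.mem_filter, Finset.mem_univ, true_and, Finset.mem_erase,
      mem_level]
    constructor
    · rintro (⟨h1, h2⟩ | ⟨h1, h2⟩)
      · exact ⟨h1.ne', h2.symm⟩
      · exact ⟨h1.ne, h2⟩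
    · rintro ⟨h1, h2⟩
      rcases lt_or_gt_of_ne h1 with h | h
      · exact Or.inr ⟨h, h2⟩
      · exact Or.inl ⟨h, h2.symm⟩
  · rw [Finset.disjoint_filter]
    exact fun p _ h1 h2 => lt_asymm h1.1 h2.1

theorem prod_Xhat {n : ℕ} (l : List (Fin (n + 1))) (g : Fun n) (x : Lat n) :
    (l.map Xhat).prod g x = g (x - (l.map v).sum) := by
  induction l generalizing x with
  | nil => simp
  | cons i l ih =>
    rw [List.map_cons, List.prod_cons, Module.End.mul_apply, Xhat_apply, ih, List.map_cons,
      List.sum_cons, sub_sub]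

theorem ind_eq_sum {n : ℕ} (J : Finset (Fin (n + 1))) : ind J = ∑ j ∈ J, v j := by
  funext k
  simp [ind, v, Finset.sum_apply, Pi.single_apply]

theorem sum_orderEmb {n r : ℕ} {M : Type*} [AddCommMonoid M] (φ : Finset (Fin (n + 1)) → M) :
    ∑ j : Fin r ↪o Fin (n + 1), φ (Finset.univ.map j.toEmbedding) =
      ∑ J ∈ Finset.powersetCard r Finset.univ, φ J := by
  refine Finset.sum_bij' (fun j _ => Finset.univ.map j.toEmbedding)
    (fun J hJ => J.orderEmbOfFin (Finset.mem_powersetCard.mp hJ).2) ?_ ?_ ?_ ?_ ?_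
  · intro j _
    simp [Finset.mem_powersetCard]
  · intro J _
    exact Finset.mem_univ _
  · intro j _
    refine (Finset.orderEmbOfFin_unique' _ fun k => ?_).symm
    simp
  · intro J hJ
    ext k
    simp
  · intro j _
    rfl

/-- A nonempty J lies in at most one level set, which accounts for the factor δ_{j_1, …, j_r}. The
empty set lies in all of them, and its contributions add up to the potential term. -/
theorem H_apply {n : ℕ} (g : Fun n) (x : Lat n) : H α β γ δ n g x = levelSum α β γ δ g x := by
  set Ψ : Finset (Fin (n + 1)) → ℂ := fun J => ∑ c ∈ Finset.univ.image x,
    if J ⊆ level x c then (coef α β γ δ (level x c).card J.card *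
      qpar α β γ δ ^ ∑ j ∈ J, dminus j x) * g (x - ind J) else 0 with hΨ
  have h1 : levelSum α β γ δ g x = ∑ J ∈ Finset.univ.powerset, Ψ J := by
    rw [hΨ, Finset.sum_comm, levelSum]
    refine Finset.sum_congr rfl fun c _ => ?_
    rw [← Finset.sum_filter]
    refine Finset.sum_congr ?_ fun J _ => rfl
    ext J
    simp
  have h2 : Ψ ∅ = -(α * γ) * (∑ j : Fin (n + 1), qint (qpar α β γ δ) (dplus j x) /
        (1 + β * γ * qint (qpar α β γ δ) (dplus j x))) * g x := by
    have hind : x - ind ∅ = x := by funext k; simp [ind]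
    simp only [hΨ, Finset.empty_subset, if_true, hind, Finset.card_empty, Finset.sum_empty,
      pow_zero, mul_one, ← Finset.sum_mul]
    congr 1
    rw [← sum_level x, Finset.mul_sum]
    refine Finset.sum_congr rfl fun c _ => ?_
    rw [coef, ← sum_card_gt]
    congr 1
    exact Finset.sum_congr rfl fun k hk => by rw [← dplus_eq hk, den]
  have h3 : ∀ r (j : Fin (r + 1) ↪o Fin (n + 1)), Ψ (Finset.univ.map j.toEmbedding) =
      (-(β * δ)) ^ r * qfact (qpar α β γ δ) r * (qpar α β γ δ ^ ((r + 1) * r / 2))⁻¹ *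
      (qpar α β γ δ ^ (∑ p, dminus (j p) x) * delta j x /
          (∏ p ∈ Finset.range (r + 1),
            (1 + β * γ * qint (qpar α β γ δ) (dplus (j 0) x + dminus (j 0) x - p))) *
          (List.ofFn fun p => Xhat (j p)).prod g x) := by
    intro r j
    have hX : (List.ofFn fun p => Xhat (j p)).prod g x =
        g (x - ind (Finset.univ.map j.toEmbedding)) := by
      have : (List.ofFn fun p => Xhat (j p)) = (List.ofFn j).map Xhat := by
        rw [List.map_ofFn]; rfl
      rw [this, prod_Xhat, List.map_ofFn, List.sum_ofFn, ind_eq_sum, Finset.sum_map]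
      rfl
    rw [hX, hΨ]
    simp only
    rw [Finset.sum_eq_single (x (j 0))]
    · by_cases hc : ∀ p p', x (j p) = x (j p')
      · rw [if_pos, delta, if_pos hc, Finset.card_map, Finset.card_univ, Fintype.card_fin, coef,
          Finset.sum_map, dplus_add_dminus]
        · simp only [den, RelEmbedding.coe_toEmbedding]
          ring
        · intro k hk
          obtain ⟨p, -, rfl⟩ := Finset.mem_map.mp hk
          exact mem_level.mpr (hc p 0)
      · rw [if_neg, delta, if_neg hc]
        · simp
        · intro h
          refine hc fun p p' => ?_
          have h1 := mem_level.mp (h (Finset.mem_map_of_mem j.toEmbedding (Finset.mem_univ p)))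
          have h2 := mem_level.mp (h (Finset.mem_map_of_mem j.toEmbedding (Finset.mem_univ p')))
          exact h1.trans h2.symm
    · intro c _ hc
      rw [if_neg]
      intro h
      exact hc (mem_level.mp (h (Finset.mem_map_of_mem j.toEmbedding (Finset.mem_univ 0)))).symm
    · intro h
      exact absurd (Finset.mem_image_of_mem x (Finset.mem_univ _)) h
  rw [h1, Finset.sum_powerset, Finset.card_univ, Fintype.card_fin, Finset.sum_range_succ',
    Finset.powersetCard_zero, Finset.sum_singleton, h2, add_comm]
  simp only [H, LinearMap.coe_mk, AddHom.coe_mk]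
  congr 1
  refine Finset.sum_congr rfl fun r _ => ?_
  rw [← sum_orderEmb, Finset.mul_sum]
  exact Finset.sum_congr rfl fun j _ => (h3 r j).symm

theorem pairing_levelSum {n : ℕ} (φ : Lat n → GrpAlg n) (f : Fun n) (x : Lat n) :
    pairing (levelSum α β γ δ φ x) f = levelSum α β γ δ (fun y => pairing (φ y) f) x := by
  simp only [levelSum, pairing_sum, pairing_smul, smul_eq_mul]

/-- The propagation operator intertwines `∑ X̂_i` with the discrete Hamiltonian. -/
theorem H_mul_G {n : ℕ} (hq : qpar α β γ δ ≠ 0) (hd : ∀ m ≤ n, den α β γ δ m ≠ 0) :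
    H α β γ δ n * G α β γ δ n = G α β γ δ n * ∑ i : Fin (n + 1), Xhat i := by
  refine LinearMap.ext fun f => funext fun x => ?_
  have hX : (∑ i : Fin (n + 1), Xhat i) f =
      transpose (LinearMap.mulLeft ℂ (∑ k, e (-v k))) f := by
    funext y
    change _ = pairing _ f
    rw [LinearMap.mulLeft_apply, Finset.sum_mul, pairing_sum, LinearMap.sum_apply,
      Finset.sum_apply]
    refine Finset.sum_congr rfl fun k _ => ?_
    rw [Xhat_apply, ← e_add, pairing_e, neg_add_eq_sub]
  have hG : G α β γ δ n f = fun y => pairing (propag α β γ δ y) f :=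
    funext fun y => G_apply α β γ δ f y
  rw [Module.End.mul_apply, Module.End.mul_apply, H_apply, hG, G_apply, hX, ← pairing_transpose,
    LinearMap.mulLeft_apply, zsum_mul_propag hq hd, pairing_levelSum]

end Params

/-! ### Injectivity of the propagation operator. -/

section Params

variable (α β γ δ : ℂ)

/-- The elements of `ℂ[L]` obtained from the `e^y` with `y` dominant by linear combinations and
by the operators `Ť_i` with `j ≤ i`. -/
inductive IsGen {n : ℕ} (j : ℕ) : GrpAlg n → Prop
  | basis (y : Lat n) : Dominant y → IsGen j (e y)
  | apply (i : Fin n) (P : GrpAlg n) : j ≤ i.val → IsGen j P → IsGen j (Tcheck α β γ δ i P)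
  | add (P Q : GrpAlg n) : IsGen j P → IsGen j Q → IsGen j (P + Q)
  | smul (c : ℂ) (P : GrpAlg n) : IsGen j P → IsGen j (c • P)

/-- The subspace of the elements which satisfy `IsGen`. -/
def gen (n j : ℕ) : Submodule ℂ (GrpAlg n) where
  carrier := {P | IsGen α β γ δ j P}
  add_mem' := IsGen.add _ _
  zero_mem' := by
    have h := IsGen.smul (α := α) (β := β) (γ := γ) (δ := δ) (j := j) 0 (e (0 : Lat n))
      (IsGen.basis 0 fun i => by simp [root])
    rwa [zero_smul] at h
  smul_mem' c P := IsGen.smul c P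

theorem gen_antitone {n j j' : ℕ} (h : j ≤ j') : gen α β γ δ n j' ≤ gen α β γ δ n j := by
  intro P hP
  induction hP with
  | basis y hy => exact IsGen.basis y hy
  | apply i P hi _ ih => exact IsGen.apply i P (h.trans hi) ih
  | add P Q _ _ hP hQ => exact IsGen.add P Q hP hQ
  | smul c P _ ih => exact IsGen.smul c P ih

/-- The span is stable under every Ť_i: upward by `Tcheck_propag`, and on a point where the sign of
the root is wrong by the quadratic relation. -/
theorem gen_le_span (n : ℕ) :
    gen α β γ δ n 0 ≤ Submodule.span ℂ (Set.range (propag α β γ δ (n := n))) := by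
  intro P hP
  induction hP with
  | basis y hy =>
    exact Submodule.subset_span ⟨y, propag_of_dominant α β γ δ hy⟩
  | add P Q _ _ hP hQ => exact add_mem hP hQ
  | smul c P _ ih => exact Submodule.smul_mem _ c ih
  | apply i P _ _ ih =>
    suffices H : Submodule.span ℂ (Set.range (propag α β γ δ (n := n))) ≤
        (Submodule.span ℂ (Set.range (propag α β γ δ))).comap (Tcheck α β γ δ i) from H ih
    refine Submodule.span_le.mpr ?_
    rintro _ ⟨x, rfl⟩
    rw [SetLike.mem_coe, Submodule.mem_comap]
    rcases le_or_gt 0 (root i x) with h | h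
    · exact Submodule.subset_span ⟨_, (Tcheck_propag α β γ δ h).symm⟩
    · rw [propag_of_root_neg α β γ δ h, Tcheck_Tcheck, ← propag_of_root_neg α β γ δ h]
      exact add_mem (Submodule.smul_mem _ _ (Submodule.subset_span ⟨_, rfl⟩))
        (Submodule.smul_mem _ _ (Submodule.subset_span ⟨_, rfl⟩))

variable {α β γ δ}

/-- The block expansion holds on any subinterval of a level set. After cutting each level at j,
building its terms from dominant monomials uses only Ť_i with i ≥ j. -/
theorem zsum_mul_e_mem_gen (hq : qpar α β γ δ ≠ 0) {n : ℕ} (hd : ∀ m ≤ n, den α β γ δ m ≠ 0)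
    (j : ℕ) {y : Lat n} (hy : Dominant y) :
    zsum n j (n + 1) * e y ∈ gen α β γ δ n j := by
  have hsum : zsum n j (n + 1) = ∑ c ∈ Finset.univ.image y,
      ∑ k ∈ level y c, if j ≤ k.val then e (-v k) else 0 := by
    rw [sum_level, ← Finset.sum_filter, zsum]
    refine Finset.sum_congr ?_ fun k _ => rfl
    ext k
    rw [mem_blk, Finset.mem_filter]
    simp only [Finset.mem_univ, true_and]
    omega
  rw [hsum, Finset.sum_mul]
  refine sum_mem fun c _ => ?_
  obtain ⟨p, d, hpd, hlev, hlt⟩ := exists_level_eq_blk hy c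
  rw [← Finset.sum_filter]
  have hblk : (level y c).filter (fun k => j ≤ k.val) = blk n (max p j) (p + d) := by
    ext k
    rw [hlev, Finset.mem_filter, mem_blk, mem_blk, max_le_iff]
    tauto
  rw [hblk, ← zsum]
  by_cases hle : max p j ≤ p + d
  · have h := zsum_eq_famSum hq (n := n) (p := max p j) (p + d - max p j)
      (fun m hm => hd m (by omega)) (by omega)
    rw [Nat.add_sub_cancel' hle] at h
    rw [h, famSum, Finset.sum_mul]
    refine sum_mem fun J hJ => ?_
    rw [smul_mul_assoc, mul_comm (blockFam _ _ _ _ _ _)]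
    refine Submodule.smul_mem _ _ ?_
    have hc : ∀ k ∈ blk n (max p j) (p + d), y k = c := fun k hk => by
      rw [← mem_level, hlev]
      rw [mem_blk] at hk ⊢
      omega
    refine family_induction
      (motive := fun J => e y * blockFam α β γ δ (p + d) J ∈ gen α β γ δ n j) ?_ ?_ hle J
      (Finset.mem_powerset.mp hJ)
    · intro m hm _
      rw [blockFam_final, ← e_add, ← sub_eq_add_neg]
      refine IsGen.basis _ (dominant_sub_ind hy (fun k hk => hc k ?_) hlt)
      rw [mem_blk] at hk ⊢
      omega
    · intro J _ i hi hie h1 _ ih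
      have hr : root i y = 0 := by
        rw [root, hc i.castSucc, hc i.succ, sub_self]
        · rw [mem_blk, Fin.val_succ]; omega
        · rw [mem_blk, Fin.val_castSucc]; omega
      rw [← Tcheck_blockFam α β γ δ hie (fun h => absurd h h1), ← Tcheck_mul]
      · exact IsGen.apply i _ (by omega) ih
      · rw [sg_e, act_s_of_root_eq_zero hr]
  · have : blk n (max p j) (p + d) = ∅ := Finset.filter_eq_empty_iff.mpr fun k _ => by omega
    rw [zsum, this, Finset.sum_empty, zero_mul]
    exact zero_mem _

theorem zsum_mul_mem_gen (hq : qpar α β γ δ ≠ 0) {n : ℕ} (hd : ∀ m ≤ n, den α β γ δ m ≠ 0)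
    (j : ℕ) {P : GrpAlg n} (hP : P ∈ gen α β γ δ n j) :
    zsum n j (n + 1) * P ∈ gen α β γ δ n j := by
  induction hP with
  | basis y hy => exact zsum_mul_e_mem_gen hq hd j hy
  | apply i P hi _ ih =>
    rw [← Tcheck_mul α β γ δ (sg_zsum hi (Nat.succ_lt_succ i.isLt))]
    exact IsGen.apply i _ hi ih
  | add P Q _ _ hP hQ => rw [mul_add]; exact add_mem hP hQ
  | smul c P _ ih => rw [mul_smul_comm]; exact Submodule.smul_mem _ c ih

/-- Descending induction on the number j of leading coordinates already in order and above all later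
ones: j = n + 1 means dominant, and j = 0 imposes nothing. -/
theorem e_mem_gen (hq : qpar α β γ δ ≠ 0) {n : ℕ} (hd : ∀ m ≤ n, den α β γ δ m ≠ 0)
    (j : ℕ) (hj : j ≤ n + 1) {x : Lat n} (hx : ∀ k l : Fin (n + 1), k ≤ l → k.val < j → x l ≤ x k) :
    e x ∈ gen α β γ δ n j := by
  induction hj using Nat.decreasingInduction generalizing x with
  | self =>
    exact IsGen.basis x (dominant_iff_antitone.mpr fun k l hkl => hx k l hkl k.isLt)
  | of_succ j hj ih =>
    let jj : Fin (n + 1) := ⟨j, by omega⟩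
    obtain ⟨m, hm, hmax⟩ := (blk n j (n + 1)).exists_max_image x ⟨jj, by
      rw [mem_blk]; exact ⟨le_rfl, jj.isLt⟩⟩
    have hle : ∀ k : Fin (n + 1), j ≤ k.val → x k ≤ x m := fun k hk =>
      hmax k (mem_blk.mpr ⟨hk, k.isLt⟩)
    -- Inner induction on the deficit t of coordinate j below the bound x m for the later
    -- coordinates. With t = 0 the hypothesis for j + 1 applies.
    have key : ∀ (t : ℕ) (y : Lat n), (∀ k : Fin (n + 1), k.val < j → y k = x k) →
        y jj = x m - t → (∀ k : Fin (n + 1), j < k.val → y k ≤ x m) →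
        e y ∈ gen α β γ δ n j := by
      intro t
      induction t with
      | zero =>
        intro y h1 h2 h3
        rw [Nat.cast_zero, sub_zero] at h2
        refine gen_antitone α β γ δ (Nat.le_succ j) (ih fun k l hkl hk => ?_)
        have hkl' : k.val ≤ l.val := hkl
        rcases Nat.lt_succ_iff_lt_or_eq.mp hk with hk | hk
        · rw [h1 k hk]
          rcases lt_trichotomy l.val j with hl | hl | hl
          · rw [h1 l hl]
            exact hx k l hkl hk
          · rw [show l = jj from Fin.ext hl, h2]
            exact hx k m (by rw [Fin.le_def]; have := mem_blk.mp hm; omega) hk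
          · exact (h3 l hl).trans
              (hx k m (by rw [Fin.le_def]; have := mem_blk.mp hm; omega) hk)
        · have hkj : k = jj := Fin.ext hk
          subst hkj
          rcases hkl'.eq_or_lt with hl | hl
          · rw [← Fin.ext hl]
          · rw [h2]
            exact h3 l (by omega)
      | succ t iht =>
        intro y h1 h2 h3
        have hne : ∀ k : Fin (n + 1), k.val ≠ j → v jj k = 0 := by
          intro k hk
          have : k ≠ jj := fun h => hk (congrArg Fin.val h)
          simp [v, this]
        have hy : e (y + v jj) ∈ gen α β γ δ n j := by
          refine iht _ (fun k hk => ?_) ?_ fun k hk => ?_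
          · rw [Pi.add_apply, hne k hk.ne, add_zero, h1 k hk]
          · rw [Pi.add_apply, h2, v, Pi.single_eq_same]
            push_cast
            ring
          · rw [Pi.add_apply, hne k hk.ne', add_zero]
            exact h3 k hk
        have hz := zsum_mul_mem_gen hq hd j hy
        have hblk : blk n j (n + 1) = insert jj (blk n (j + 1) (n + 1)) :=
          blk_succ_left (p := jj) jj.isLt
        have hnot : jj ∉ blk n (j + 1) (n + 1) := notMem_blk_left (p := jj)
        -- Multiplying e^{y + v_j} by z_j + z_{j+1} + ⋯ gives e^y plus terms in which a later
        -- coordinate is lowered instead. Those still have deficit t, so they lie in `gen` and e^y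
        -- can be isolated.
        rw [zsum, hblk, Finset.sum_insert hnot, add_mul, ← e_add, neg_add_eq_sub,
          add_sub_cancel_right, Finset.sum_mul] at hz
        refine (Submodule.add_mem_iff_left _ (sum_mem fun l hl => ?_)).mp hz
        rw [mem_blk] at hl
        have hlj : jj ≠ l := fun h => by
          have : j = l.val := congrArg Fin.val h
          omega
        rw [← e_add, neg_add_eq_sub]
        have hvl : ∀ k : Fin (n + 1), v l k = 0 ∨ v l k = 1 := by
          intro k
          by_cases hk : k = l
          · right; simp [v, hk]
          · left; simp [v, hk]
        refine iht _ (fun k hk => ?_) ?_ fun k hk => ?_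
        · have : k ≠ l := fun h => by rw [h] at hk; omega
          rw [Pi.sub_apply, Pi.add_apply, hne k hk.ne, h1 k hk]
          simp [v, this]
        · rw [Pi.sub_apply, Pi.add_apply, h2]
          simp [v, hlj]
          ring
        · rw [Pi.sub_apply, Pi.add_apply, hne k hk.ne']
          have := h3 k hk
          rcases hvl k with h | h <;> omega
    refine key (x m - x jj).toNat x (fun _ _ => rfl) ?_ fun k hk => hle k hk.le
    rw [Int.toNat_of_nonneg (sub_nonneg.mpr (hle jj le_rfl))]
    ring

/-- If G f = 0, then f pairs to zero with every `propag y`, hence with their span, which contains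
every e^x. -/
theorem G_injective (hq : qpar α β γ δ ≠ 0) {n : ℕ} (hd : ∀ m ≤ n, den α β γ δ m ≠ 0)
    {f : Fun n} (hf : G α β γ δ n f = 0) : f = 0 := by
  funext x
  have hx : e x ∈ gen α β γ δ n 0 := e_mem_gen hq hd 0 (Nat.zero_le _) fun k l _ h =>
    absurd h (Nat.not_lt_zero _)
  have hker : Submodule.span ℂ (Set.range (propag α β γ δ)) ≤ LinearMap.ker (extend f) := by
    refine Submodule.span_le.mpr ?_
    rintro _ ⟨y, rfl⟩
    have := congrFun hf y
    rwa [G_apply] at this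
  have h := hker (gen_le_span α β γ δ n hx)
  rwa [LinearMap.mem_ker, extend_e] at h

end Params

end DeformedHecke

end

theorem mainTheorem1 (n : ℕ) (hn : 1 ≤ n) (α β γ δ : ℂ)
    (hq : DeformedHecke.qpar α β γ δ ≠ 0)
    (hne : ∀ m : ℕ, 1 ≤ m → 1 + β * γ * DeformedHecke.qint (DeformedHecke.qpar α β γ δ) m ≠ 0) :
    DeformedHecke.H α β γ δ n * DeformedHecke.G α β γ δ n =
        DeformedHecke.G α β γ δ n * ∑ i : Fin (n + 1), DeformedHecke.Xhat i ∧
      ∀ (f : DeformedHecke.Fun n) (c : ℂ),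
        Module.End.HasEigenvector (∑ i : Fin (n + 1), DeformedHecke.Xhat i) c f →
          Module.End.HasEigenvector (DeformedHecke.H α β γ δ n) c
            (DeformedHecke.G α β γ δ n f) := by
  have hd : ∀ m ≤ n, DeformedHecke.den α β γ δ m ≠ 0 := by
    rintro (_ | m) _
    · simp [DeformedHecke.den, DeformedHecke.qint]
    · exact hne (m + 1) (by omega)
  have hHG := DeformedHecke.H_mul_G hq hd
  refine ⟨hHG, fun f c hf => ?_⟩
  rw [Module.End.hasEigenvector_iff, Module.End.mem_eigenspace_iff] at hf ⊢
  refine ⟨?_, fun h => hf.2 (DeformedHecke.G_injective hq hd h)⟩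
  have h := LinearMap.congr_fun hHG f
  rw [Module.End.mul_apply, Module.End.mul_apply, hf.1, map_smul] at h
  exact h
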